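/- **Theorem (Local profile of the global minimizer).** Let $\mu\in C^1(\mathbb{R})\cap L^\infty(\mathbb{R})$ be even with $\mu'<0$ on $(0,\infty)$ and $\mu(\xi)=0$ for a (necessarily unique) $\xi>0$, and let $f\in L^1(\mathbb{R})\cap L^\infty(\mathbb{R})\cap C(\mathbb{R})$ be odd with $f(x)>0$ for all $x>0$. Fix $a\ge 0$, and for $\epsilon>0$ consider $$E_\epsilon(u)=\int_{\mathbb{R}}\Big(\frac{\epsilon}{2}|u'(x)|^2-\frac{1}{2\epsilon}\mu(x)u^2(x)+\frac{1}{4\epsilon}|u(x)|^4-a f(x)u(x)\Big)\,dx,\qquad u\in H^1(\mathbb{R}).$$ Let $\mu_1:=\mu'(\xi)<0$ and $\alpha:=\dfrac{a f(\xi)}{\sqrt2\,\mu_1}$; then $\alpha\le 0$, and $\alpha<0$ if $a>0$. For $\epsilon>0$ let $v_\epsilon$ be (the continuous representative of) a global minimizer of $E_\epsilon$ in $H^1(\mathbb{R})$, and set $$w_\epsilon^\pm(s)=\pm 2^{-1/2}(-\mu_1\epsilon)^{-1/3}\,v_\epsilon\Big(\pm\xi\pm\epsilon^{2/3}\frac{s}{(-\mu_1)^{1/3}}\Big),\qquad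 s\in\mathbb{R}.$$ Then for every sequence $\epsilon_n>0$ with $\epsilon_n\to0$ and every choice of global minimizers $v_{\epsilon_n}$ there is a subsequence along which $w^+_{\epsilon_n}$ and $w^-_{\epsilon_n}$ converge in $C^1_{\mathrm{loc}}(\mathbb{R})$, each of them to a minimal solution $y$, bounded in a neighbourhood of $+\infty$, of the second Painlevé equation $$y''(s)-s\,y(s)-2y^3(s)-\alpha=0,\qquad s\in\mathbb{R}.$$ Here a solution $y\in C^2(\mathbb{R})$ is called minimal if for all $\phi\in C_0^\infty(\mathbb{R})$ $$\int_{\operatorname{supp}\phi}\Big[\tfrac12|y'|^2+\tfrac12 s y^2+\tfrac12 y^4+\alpha y\Big]ds\;\le\;\int_{\operatorname{supp}\phi}\Big[\tfrac12|(y+\phi)'|^2+\tfrac12 s (y+\phi)^2+\tfrac12 (y+\phi)^4+\alpha (y+\phi)\Big]ds .$$ -/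

import Mathlib

open MeasureTheory Filter Topology
open scoped ContDiff

noncomputable section

/-- `g` is a weak derivative of `u` on `ℝ`, and `u` and `g` are both in `L²(ℝ)`. Hence `u ∈ H¹(ℝ)`
means that there is a `g` with `IsH1With u g`; such a `g` is unique almost everywhere. -/
structure IsH1With (u g : ℝ → ℝ) : Prop where
  memLp : MemLp u 2 volume
  memLp_weakDeriv : MemLp g 2 volume
  integral_mul_deriv : ∀ φ : ℝ → ℝ, ContDiff ℝ ∞ φ → HasCompactSupport φ →
    ∫ x, u x * deriv φ x = -∫ x, g x * φ x

/-- The energy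
`E(u) = ∫ (ε/2) |u'|² - (1/(2ε)) μ u² + (1/(4ε)) |u|⁴ - a f u` of `u ∈ H¹(ℝ)`,
where `u'` is the weak derivative of `u`. -/
def lightEnergy (μ f : ℝ → ℝ) (a ε : ℝ) (u u' : ℝ → ℝ) : ℝ :=
  ∫ x, (ε / 2 * |u' x| ^ 2 - 1 / (2 * ε) * μ x * u x ^ 2 + 1 / (4 * ε) * |u x| ^ 4 - a * f x * u x)

/-- `v` is a global minimizer of the energy in `H¹(ℝ)`. As every class in `H¹(ℝ)` has exactly one
continuous representative, pointwise values of `v` are those of that representative. -/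
def IsGlobalMinimizer (μ f : ℝ → ℝ) (a ε : ℝ) (v : ℝ → ℝ) : Prop :=
  Continuous v ∧ ∃ v' : ℝ → ℝ, IsH1With v v' ∧
    ∀ u u' : ℝ → ℝ, IsH1With u u' → lightEnergy μ f a ε v v' ≤ lightEnergy μ f a ε u u'

/-- `σ 2^(-1/2) (-μ₁ ε)^(-1/3) v(σ ξ + σ ε^(2/3) s / (-μ₁)^(1/3))` as a function of `s`; the sign
`σ = 1` gives `w⁺` and `σ = -1` gives `w⁻`. -/
def rescaledProfile (σ μ₁ ξ ε : ℝ) (v : ℝ → ℝ) (s : ℝ) : ℝ :=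
  σ * (2 : ℝ) ^ (-(1 / 2) : ℝ) * (-μ₁ * ε) ^ (-(1 / 3) : ℝ) *
    v (σ * ξ + σ * (ε ^ (2 / 3 : ℝ) * (s / (-μ₁) ^ (1 / 3 : ℝ))))

/-- `y` is a classical solution on `ℝ` of `y'' - s y - 2 y³ - α = 0`. -/
def IsPainleveTwoSolution (α : ℝ) (y : ℝ → ℝ) : Prop :=
  ContDiff ℝ 2 y ∧ ∀ s : ℝ, deriv (deriv y) s - s * y s - 2 * y s ^ 3 - α = 0

/-- The energy associated with the second Painlevé equation on the set `I`. -/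
def painleveTwoEnergy (α : ℝ) (u : ℝ → ℝ) (I : Set ℝ) : ℝ :=
  ∫ s in I, (1 / 2 * |deriv u s| ^ 2 + 1 / 2 * s * u s ^ 2 + 1 / 2 * u s ^ 4 + α * u s)

/-- `y` is a minimal solution of the second Painlevé equation. -/
def IsMinimalPainleveTwoSolution (α : ℝ) (y : ℝ → ℝ) : Prop :=
  IsPainleveTwoSolution α y ∧
    ∀ φ : ℝ → ℝ, ContDiff ℝ ∞ φ → HasCompactSupport φ →
      painleveTwoEnergy α y (tsupport φ) ≤ painleveTwoEnergy α (fun s => y s + φ s) (tsupport φ)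

/-- `y` is bounded in a neighbourhood of `+∞`. -/
def BoundedAtTop (y : ℝ → ℝ) : Prop :=
  ∃ M : ℝ, ∀ᶠ s in atTop, |y s| ≤ M

/-- Convergence in `C¹_loc(ℝ)`: all functions are `C¹`, and the functions and their derivatives
converge uniformly on compact sets. -/
def TendstoC1Loc (w : ℕ → ℝ → ℝ) (y : ℝ → ℝ) : Prop :=
  (∀ n, ContDiff ℝ 1 (w n)) ∧ ContDiff ℝ 1 y ∧
    TendstoLocallyUniformly w y atTop ∧
    TendstoLocallyUniformly (fun n => deriv (w n)) (deriv y) atTop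

end

/-! A minimizer satisfies `ε² v'' = v³ - μ v - ε a f`. Near the simple zero `ξ` of `μ`, put `m =
-μ'(ξ)` and `w(s) = v(ξ + l s) / c`. The choice `l³ m = ε²`, `c l = √2 ε` balances all the terms and
gives `w'' = 2 w³ + p w + q` with `p(s) = -μ(ξ + l s) / (m l) → s` and `q(s) = -a f(ξ + l s) / (√2
m) → α`, locally uniformly as `ε → 0`.

Compactness comes from the cubic term alone. By a Keller-Osserman argument,
`le_of_cube_le_deriv_deriv`, the value of `w` at a point is bounded in terms of `p` and `q` on the
surrounding interval of radius one, so no global estimate on `v` is needed. The Cauchy data at `0`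
are therefore bounded; once they converge along a subsequence, Grönwall's inequality makes `w`, `w'`
and `w''` uniformly Cauchy on compact sets, and the limit solves the Painlevé equation
(`exists_subseq_tendsto_of_perturbed_painleve`). The same bound, applied to the limit where `s ≥ 0`,
gives boundedness at `+∞`.

Minimality is inherited because the energy difference under a compactly supported variation is an
integral over its support. It is nonnegative for `v`, hence after rescaling for `w`
(`IsGlobalMinimizer.rescale`), and dominated convergence carries it to the limit.

Finally, `v ↦ -v(-·)` preserves the energy since `μ` is even and `f` odd, which reduces the profile
at `-ξ` to the one at `ξ`. -/

/-! ### Weak derivatives on the line. -/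

theorem HasCompactSupport.exists_forall_notMem_tsupport {φ : ℝ → ℝ} (hc : HasCompactSupport φ) :
    ∃ S : ℝ, 0 < S ∧ ∀ x, S ≤ |x| → x ∉ tsupport φ := by
  obtain ⟨R, hR⟩ := hc.isCompact.isBounded.subset_closedBall 0
  refine ⟨|R| + 1, by positivity, fun x hx h => ?_⟩
  have := hR h
  rw [mem_closedBall_zero_iff, Real.norm_eq_abs] at this
  linarith [le_abs_self R]

/-- A smooth compactly supported function of zero mean is the derivative of such a function. -/
theorem exists_testFunction_deriv_eq {χ : ℝ → ℝ} (hχ : ContDiff ℝ ∞ χ)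
    (hc : HasCompactSupport χ) (h0 : ∫ x, χ x = 0) :
    ∃ φ : ℝ → ℝ, ContDiff ℝ ∞ φ ∧ HasCompactSupport φ ∧ deriv φ = χ := by
  obtain ⟨R, hR, hR'⟩ := hc.exists_forall_notMem_tsupport
  have hz : ∀ x, R ≤ |x| → χ x = 0 := fun x hx => image_eq_zero_of_notMem_tsupport (hR' x hx)
  have hd : ∀ x, HasDerivAt (fun x => ∫ t in (-R)..x, χ t) (χ x) x := fun x =>
    hχ.continuous.integral_hasStrictDerivAt _ _ |>.hasDerivAt
  have hd' : deriv (fun x => ∫ t in (-R)..x, χ t) = χ := funext fun x => (hd x).deriv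
  -- This primitive vanishes to the left of `-R` by the support of `χ`, and to the right of `R` by
  -- the zero mean.
  refine ⟨fun x => ∫ t in (-R)..x, χ t, ?_, ?_, hd'⟩
  · rw [contDiff_infty_iff_deriv, hd']
    exact ⟨fun x => (hd x).differentiableAt, hχ⟩
  · refine HasCompactSupport.intro (isCompact_Icc (a := -R) (b := R)) fun x hx => ?_
    rw [Set.mem_Icc, not_and_or, not_le, not_le] at hx
    rcases hx with hx | hx
    · rw [intervalIntegral.integral_symm, intervalIntegral.integral_of_le hx.le,
        setIntegral_eq_zero_of_forall_eq_zero, neg_zero]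
      exact fun t ht => hz t (by rw [abs_of_nonpos (by linarith [ht.2])]; linarith [ht.2])
    · rw [← h0, intervalIntegral.integral_of_le (by linarith)]
      refine setIntegral_eq_integral_of_forall_compl_eq_zero fun t ht => hz t ?_
      rw [Set.mem_Ioc, not_and_or, not_lt, not_le] at ht
      rcases ht with ht | ht
      · rw [abs_of_nonpos (by linarith)]; linarith
      · rw [abs_of_pos (by linarith)]; linarith

/-- The du Bois-Reymond lemma. -/
theorem ae_eq_const_of_integral_mul_deriv_eq_zero {z : ℝ → ℝ} (hz : LocallyIntegrable z)
    (h : ∀ φ : ℝ → ℝ, ContDiff ℝ ∞ φ → HasCompactSupport φ → ∫ x, z x * deriv φ x = 0) :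
    ∃ c : ℝ, z =ᵐ[volume] fun _ => c := by
  obtain ⟨b⟩ : Nonempty (ContDiffBump (0 : ℝ)) := inferInstance
  set ψ₀ : ℝ → ℝ := b.normed volume with hψ₀
  have hψ₀s : ContDiff ℝ ∞ ψ₀ := b.contDiff_normed
  have hψ₀c : HasCompactSupport ψ₀ := b.hasCompactSupport_normed
  have hψ₀i : ∫ x, ψ₀ x = 1 := b.integral_normed
  have hint : ∀ ψ : ℝ → ℝ, ContDiff ℝ ∞ ψ → HasCompactSupport ψ →
      Integrable (fun x => ψ x * z x) := fun ψ h1 h2 => by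
    simpa using hz.integrable_smul_left_of_hasCompactSupport h1.continuous h2
  refine ⟨∫ x, ψ₀ x * z x, ?_⟩
  refine ae_eq_of_integral_contDiff_smul_eq hz (locallyIntegrable_const _) fun ψ hψ hψc => ?_
  simp only [smul_eq_mul]
  -- Subtracting the multiple of a unit-mass bump with the same integral leaves zero mean, hence the
  -- derivative of a test function.
  obtain ⟨φ, hφ, hφc, hφd⟩ := exists_testFunction_deriv_eq (χ := fun x => ψ x - (∫ t, ψ t) * ψ₀ x)
    (hψ.sub (contDiff_const.mul hψ₀s)) (hψc.sub hψ₀c.mul_left) (by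
      rw [integral_sub (hψ.continuous.integrable_of_hasCompactSupport hψc)
        ((hψ₀s.continuous.integrable_of_hasCompactSupport hψ₀c).const_mul _),
        integral_const_mul, hψ₀i]; simp)
  have h1 := h φ hφ hφc
  have h2 : (fun x => z x * deriv φ x) =
      fun x => ψ x * z x - (∫ t, ψ t) * (ψ₀ x * z x) := by
    rw [hφd]; funext x; ring
  rw [h2, integral_sub (hint ψ hψ hψc) ((hint ψ₀ hψ₀s hψ₀c).const_mul _), integral_const_mul,
    sub_eq_zero] at h1
  rw [h1, integral_mul_const]

theorem intervalIntegrable_of_locallyIntegrable {h : ℝ → ℝ} (hh : LocallyIntegrable h) (a b : ℝ) :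
    IntervalIntegrable h volume a b :=
  (hh.integrableOn_isCompact isCompact_uIcc).intervalIntegrable

/-- A primitive of a locally integrable function has that function as its weak derivative. -/
theorem integral_primitive_mul_deriv {h φ : ℝ → ℝ} (hh : LocallyIntegrable h)
    (hφ : ContDiff ℝ ∞ φ) (hc : HasCompactSupport φ) :
    ∫ x, (∫ t in (0 : ℝ)..x, h t) * deriv φ x = -∫ x, h x * φ x := by
  obtain ⟨S, hS0, hS⟩ := hc.exists_forall_notMem_tsupport
  have hn : ∀ x, x ∉ Set.Ioc (-S) S → S ≤ |x| := fun x hx => by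
    rw [Set.mem_Ioc, not_and_or, not_lt, not_le] at hx
    rcases hx with hx | hx
    · rw [abs_of_nonpos (by linarith)]; linarith
    · rw [abs_of_pos (by linarith)]; linarith
  have hz' : ∀ x, S ≤ |x| → φ x = 0 := fun x hx => image_eq_zero_of_notMem_tsupport (hS x hx)
  have hz : ∀ x, x ∉ Set.Ioc (-S) S → φ x = 0 := fun x hx => hz' x (hn x hx)
  have hzd : ∀ x, x ∉ Set.Ioc (-S) S → deriv φ x = 0 := fun x hx =>
    image_eq_zero_of_notMem_tsupport fun h => hS x (hn x hx) (tsupport_deriv_subset h)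
  have key := ((intervalIntegrable_of_locallyIntegrable hh
    (-S) S).absolutelyContinuousOnInterval_intervalIntegral
      (c := 0) (by rw [Set.uIcc_of_le (by linarith)]; constructor <;> linarith)
      ).integral_mul_deriv_eq_deriv_mul
    ((hφ.of_le (by simp)).contDiffOn.absolutelyContinuousOnInterval (f := φ))
  rw [hz' S (le_abs_self S), hz' (-S) (by rw [abs_neg]; exact le_abs_self S), mul_zero,
    mul_zero, sub_zero, zero_sub] at key
  rw [intervalIntegral.integral_of_le (by linarith), intervalIntegral.integral_of_le (by linarith),
    setIntegral_eq_integral_of_forall_compl_eq_zero (fun x hx => by rw [hzd x hx, mul_zero]),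
    setIntegral_eq_integral_of_forall_compl_eq_zero (fun x hx => by rw [hz x hx, mul_zero])] at key
  rw [key]
  congr 1
  apply integral_congr_ae
  filter_upwards [_root_.LocallyIntegrable.ae_hasDerivAt_integral hh] with x hx
  rw [(hx 0).deriv]

/-- A locally integrable function with a locally integrable weak derivative is a primitive of it. -/
theorem ae_eq_primitive_of_weakDeriv {z h : ℝ → ℝ} (hz : LocallyIntegrable z)
    (hh : LocallyIntegrable h)
    (H : ∀ φ : ℝ → ℝ, ContDiff ℝ ∞ φ → HasCompactSupport φ →
      ∫ x, z x * deriv φ x = -∫ x, h x * φ x) :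
    ∃ c : ℝ, z =ᵐ[volume] fun x => c + ∫ t in (0 : ℝ)..x, h t := by
  have hcont : Continuous fun x => ∫ t in (0 : ℝ)..x, h t :=
    intervalIntegral.continuous_primitive (intervalIntegrable_of_locallyIntegrable hh) 0
  obtain ⟨c, hc⟩ := ae_eq_const_of_integral_mul_deriv_eq_zero
    (z := fun x => z x - ∫ t in (0 : ℝ)..x, h t) (hz.sub hcont.locallyIntegrable) (by
      intro φ hφ hφc
      have hd : Continuous (deriv φ) := hφ.continuous_deriv (by simp)
      have h1 : Integrable fun x => z x * deriv φ x := by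
        simpa using hz.integrable_smul_right_of_hasCompactSupport hd hφc.deriv
      have h2 : Integrable fun x => (∫ t in (0 : ℝ)..x, h t) * deriv φ x :=
        (hcont.mul hd).integrable_of_hasCompactSupport hφc.deriv.mul_left
      simp only [sub_mul]
      rw [integral_sub h1 h2, H φ hφ hφc, integral_primitive_mul_deriv hh hφ hφc, sub_self])
  refine ⟨c, ?_⟩
  filter_upwards [hc] with x hx
  rw [← hx]; ring

/-! ### Functions in `H¹(ℝ)` and integrability of the energy density. -/

/-- A continuous function in `H¹(ℝ)` is bounded. -/
theorem IsH1With.bounded {u g : ℝ → ℝ} (h : IsH1With u g) (hu : Continuous u) :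
    ∃ M : ℝ, ∀ x, |u x| ≤ M := by
  have hg : LocallyIntegrable g := h.memLp_weakDeriv.locallyIntegrable (by norm_num)
  obtain ⟨c, hc⟩ := ae_eq_primitive_of_weakDeriv hu.locallyIntegrable hg h.integral_mul_deriv
  have hcont : Continuous fun x => ∫ t in (0 : ℝ)..x, g t :=
    intervalIntegral.continuous_primitive (intervalIntegrable_of_locallyIntegrable hg) 0
  have hu' := (Continuous.ae_eq_iff_eq volume hu (continuous_const.add hcont)).1 hc
  have hgi := intervalIntegrable_of_locallyIntegrable hg
  have hu2 : Integrable fun x => u x ^ 2 := h.memLp.integrable_sq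
  have hg2 : Integrable fun x => g x ^ 2 := h.memLp_weakDeriv.integrable_sq
  have hle : ∀ w : ℝ → ℝ, Integrable (fun x => w x ^ 2) →
      (∀ a b, IntervalIntegrable w volume a b) → ∀ x y, x ≤ y → y ≤ x + 1 →
      ∫ t in x..y, |w t| ≤ 1 + ∫ t, w t ^ 2 := by
    intro w hw2 hw x y hxy hy
    calc ∫ t in x..y, |w t| ≤ ∫ t in x..y, (1 + w t ^ 2) := by
          refine intervalIntegral.integral_mono_on hxy (hw x y).abs
            (intervalIntegrable_const.add hw2.intervalIntegrable) fun t _ => ?_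
          rw [← sq_abs]
          nlinarith [sq_nonneg (|w t| - 1), abs_nonneg (w t)]
      _ = (y - x) + ∫ t in x..y, w t ^ 2 := by
          rw [intervalIntegral.integral_add intervalIntegrable_const hw2.intervalIntegrable]
          simp
      _ ≤ 1 + ∫ t, w t ^ 2 := by
          gcongr
          · linarith
          · rw [intervalIntegral.integral_of_le hxy]
            exact setIntegral_le_integral hw2 (Eventually.of_forall fun t => sq_nonneg _)
  -- Averaging `|u x| ≤ |u y| + ∫ |g|` over `y ∈ [x, x + 1]` and using `|r| ≤ 1 + r²` for both `u`
  -- and `g` produces this bound.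
  refine ⟨(1 + ∫ t, u t ^ 2) + (1 + ∫ t, g t ^ 2), fun x => ?_⟩
  have h1 : ∀ y ∈ Set.Icc x (x + 1), |u x| ≤ |u y| + (1 + ∫ t, g t ^ 2) := fun y hy => by
    have e : u y - u x = ∫ t in x..y, g t := by
      rw [congrFun hu' y, congrFun hu' x, Pi.add_apply, Pi.add_apply, add_sub_add_left_eq_sub]
      exact intervalIntegral.integral_interval_sub_left (hgi _ _) (hgi _ _)
    have e1 : |u y - u x| ≤ 1 + ∫ t, g t ^ 2 := by
      rw [e]
      exact (intervalIntegral.abs_integral_le_integral_abs hy.1).trans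
        (hle g hg2 hgi x y hy.1 hy.2)
    have := abs_sub_abs_le_abs_sub (u x) (u y)
    rw [abs_sub_comm] at this
    linarith
  have h2 : ∫ _ in x..(x + 1), |u x| ≤ ∫ y in x..(x + 1), (|u y| + (1 + ∫ t, g t ^ 2)) :=
    intervalIntegral.integral_mono_on (by linarith) intervalIntegrable_const
      ((hu.abs.add continuous_const).intervalIntegrable _ _) h1
  rw [intervalIntegral.integral_add (hu.abs.intervalIntegrable _ _) intervalIntegrable_const] at h2
  have h3 := hle u hu2 (fun a b => hu.intervalIntegrable a b) x (x + 1) (by linarith) le_rfl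
  simp at h2
  linarith

theorem IsH1With.add_testFunction {v g φ : ℝ → ℝ} (h : IsH1With v g) (hφ : ContDiff ℝ ∞ φ)
    (hc : HasCompactSupport φ) :
    IsH1With (fun x => v x + φ x) (fun x => g x + deriv φ x) := by
  have hd : Continuous (deriv φ) := hφ.continuous_deriv (by simp)
  refine ⟨h.memLp.add (hφ.continuous.memLp_of_hasCompactSupport hc),
    h.memLp_weakDeriv.add (hd.memLp_of_hasCompactSupport hc.deriv), fun ψ hψ hψc => ?_⟩
  have hdψ : Continuous (deriv ψ) := hψ.continuous_deriv (by simp)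
  have hv : LocallyIntegrable v := h.memLp.locallyIntegrable (by norm_num)
  have hg : LocallyIntegrable g := h.memLp_weakDeriv.locallyIntegrable (by norm_num)
  have i1 : Integrable fun x => v x * deriv ψ x := by
    simpa using hv.integrable_smul_right_of_hasCompactSupport hdψ hψc.deriv
  have i2 : Integrable fun x => g x * ψ x := by
    simpa using hg.integrable_smul_right_of_hasCompactSupport hψ.continuous hψc
  have i3 : Integrable fun x => φ x * deriv ψ x :=
    (hφ.continuous.mul hdψ).integrable_of_hasCompactSupport hc.mul_right
  have i4 : Integrable fun x => deriv φ x * ψ x :=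
    (hd.mul hψ.continuous).integrable_of_hasCompactSupport hψc.mul_left
  have i5 : Integrable fun x => φ x * ψ x :=
    (hφ.continuous.mul hψ.continuous).integrable_of_hasCompactSupport hψc.mul_left
  simp only [add_mul]
  rw [integral_add i1 i3, integral_add i2 i4, h.integral_mul_deriv ψ hψ hψc,
    integral_mul_deriv_eq_deriv_mul_of_integrable
      (fun x _ => (hφ.differentiable (by simp) x).hasDerivAt)
      (fun x _ => (hψ.differentiable (by simp) x).hasDerivAt) i3 i4 i5]
  ring

/-- Energies can be subtracted under the integral sign only if both densities are integrable. The
quartic and the linear term are so because an `H¹` function is bounded. -/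
theorem integrable_lightEnergy {μ f v g : ℝ → ℝ} (a ε : ℝ) (hμ : Continuous μ)
    (hμb : ∃ M : ℝ, ∀ x, |μ x| ≤ M) (hf : Integrable f) (h : IsH1With v g) (hv : Continuous v) :
    Integrable fun x => ε / 2 * |g x| ^ 2 - 1 / (2 * ε) * μ x * v x ^ 2 + 1 / (4 * ε) * |v x| ^ 4
      - a * f x * v x := by
  obtain ⟨K, hK⟩ := hμb
  obtain ⟨M, hM⟩ := h.bounded hv
  have hv2 : Integrable fun x => v x ^ 2 := h.memLp.integrable_sq
  have hg2 : Integrable fun x => g x ^ 2 := h.memLp_weakDeriv.integrable_sq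
  have i1 : Integrable fun x => μ x * v x ^ 2 :=
    hv2.bdd_mul hμ.aestronglyMeasurable (Eventually.of_forall hK)
  have i2 : Integrable fun x => v x ^ 2 * v x ^ 2 :=
    hv2.bdd_mul (c := M ^ 2) (hv.pow 2).aestronglyMeasurable (Eventually.of_forall fun x => by
      rw [norm_pow]; exact pow_le_pow_left₀ (norm_nonneg _) (hM x) 2)
  have i3 : Integrable fun x => v x * f x :=
    hf.bdd_mul hv.aestronglyMeasurable (Eventually.of_forall hM)
  refine ((((hg2.const_mul (ε / 2)).sub (i1.const_mul (1 / (2 * ε)))).add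
    (i2.const_mul (1 / (4 * ε)))).sub (i3.const_mul a)).congr (Eventually.of_forall fun x => ?_)
  simp only [Pi.sub_apply, Pi.add_apply]
  rw [sq_abs, show |v x| ^ 4 = v x ^ 4 from (by norm_num : Even 4).pow_abs (v x)]
  ring

/-! ### Variations, the Euler-Lagrange equation and rescaling. -/

/-- The energy of a global minimizer does not decrease under compactly supported variations, the
difference of the energies being an integral over a bounded set. -/
theorem IsGlobalMinimizer.exists_variation_nonneg {μ f v : ℝ → ℝ} {a ε : ℝ} (hμ : Continuous μ)
    (hμb : ∃ M : ℝ, ∀ x, |μ x| ≤ M) (hf : Integrable f)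
    (h : IsGlobalMinimizer μ f a ε v) :
    ∃ g : ℝ → ℝ, LocallyIntegrable g ∧
      (∀ φ : ℝ → ℝ, ContDiff ℝ ∞ φ → HasCompactSupport φ →
        ∫ x, v x * deriv φ x = -∫ x, g x * φ x) ∧
      ∀ φ : ℝ → ℝ, ContDiff ℝ ∞ φ → HasCompactSupport φ →
        0 ≤ ∫ x, (ε / 2 * (2 * g x * deriv φ x + deriv φ x ^ 2)
          - 1 / (2 * ε) * μ x * (2 * v x * φ x + φ x ^ 2)
          + 1 / (4 * ε) * ((v x + φ x) ^ 4 - v x ^ 4) - a * f x * φ x) := by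
  obtain ⟨hv, g, hg, hmin⟩ := h
  refine ⟨g, hg.memLp_weakDeriv.locallyIntegrable (by norm_num), hg.integral_mul_deriv,
    fun φ hφ hc => ?_⟩
  have h1 := hg.add_testFunction hφ hc
  have h2 := hmin _ _ h1
  have i1 := integrable_lightEnergy a ε hμ hμb hf hg hv
  have i2 := integrable_lightEnergy a ε hμ hμb hf h1 (hv.add hφ.continuous)
  rw [lightEnergy, lightEnergy, ← sub_nonneg, ← integral_sub i2 i1] at h2
  convert h2 using 3 with x
  have e4 : ∀ r : ℝ, |r| ^ 4 = r ^ 4 := fun r => (by norm_num : Even 4).pow_abs r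
  rw [sq_abs, sq_abs, e4, e4]
  ring

/-- The variation along `t φ` is exactly a quartic polynomial in `t`, so this yields the
Euler-Lagrange equation without differentiating under the integral. -/
theorem eq_zero_of_forall_quartic_nonneg {A B C D : ℝ}
    (h : ∀ t : ℝ, 0 ≤ t * A + t ^ 2 * B + t ^ 3 * C + t ^ 4 * D) : A = 0 := by
  have hd : HasDerivAt (fun t : ℝ => t * A + t ^ 2 * B + t ^ 3 * C + t ^ 4 * D) A 0 := by
    have := ((((hasDerivAt_id (0 : ℝ)).mul_const A).add ((hasDerivAt_pow 2 (0 : ℝ)).mul_const B)).add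
      ((hasDerivAt_pow 3 (0 : ℝ)).mul_const C)).add ((hasDerivAt_pow 4 (0 : ℝ)).mul_const D)
    exact this.congr_deriv (by simp)
  have hm : IsLocalMin (fun t : ℝ => t * A + t ^ 2 * B + t ^ 3 * C + t ^ 4 * D) 0 :=
    Eventually.of_forall fun t => by simpa using h t
  exact hm.hasDerivAt_eq_zero hd

/-- Regularity and the Euler-Lagrange equation of local minimizers of
`∫ ½ |v'|² + ½ p v² + ½ k v⁴ + q v`. -/
theorem exists_hasDerivAt_of_variation_nonneg {v g p q : ℝ → ℝ} {k : ℝ} (hv : Continuous v)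
    (hg : LocallyIntegrable g) (hp : Continuous p) (hq : Continuous q)
    (hw : ∀ φ : ℝ → ℝ, ContDiff ℝ ∞ φ → HasCompactSupport φ →
      ∫ x, v x * deriv φ x = -∫ x, g x * φ x)
    (hmin : ∀ φ : ℝ → ℝ, ContDiff ℝ ∞ φ → HasCompactSupport φ →
      0 ≤ ∫ x, (g x * deriv φ x + deriv φ x ^ 2 / 2 + p x / 2 * (2 * v x * φ x + φ x ^ 2)
        + k / 2 * ((v x + φ x) ^ 4 - v x ^ 4) + q x * φ x)) :
    ∃ v₁ : ℝ → ℝ, g =ᵐ[volume] v₁ ∧ (∀ x, HasDerivAt v (v₁ x) x) ∧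
      ∀ x, HasDerivAt v₁ (2 * k * v x ^ 3 + p x * v x + q x) x := by
  have hhc : Continuous fun x => 2 * k * v x ^ 3 + p x * v x + q x := by fun_prop
  have weak : ∀ φ : ℝ → ℝ, ContDiff ℝ ∞ φ → HasCompactSupport φ →
      ∫ x, g x * deriv φ x = -∫ x, (2 * k * v x ^ 3 + p x * v x + q x) * φ x := by
    intro φ hφ hc
    have hφ0 := hφ.continuous
    have hd : Continuous (deriv φ) := hφ.continuous_deriv (by simp)
    have i1 : Integrable fun x => g x * deriv φ x := by
      simpa using hg.integrable_smul_right_of_hasCompactSupport hd hc.deriv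
    have i2 : Integrable fun x => (2 * k * v x ^ 3 + p x * v x + q x) * φ x :=
      (hhc.mul hφ0).integrable_of_hasCompactSupport hc.mul_left
    have hz : ∀ x, x ∉ tsupport φ → φ x = 0 ∧ deriv φ x = 0 := fun x hx =>
      ⟨image_eq_zero_of_notMem_tsupport hx,
        image_eq_zero_of_notMem_tsupport fun h => hx (tsupport_deriv_subset h)⟩
    have ic : ∀ F : ℝ → ℝ, Continuous F → (∀ x, x ∉ tsupport φ → F x = 0) → Integrable F :=
      fun F hF h0 => hF.integrable_of_hasCompactSupport (HasCompactSupport.intro hc h0)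
    have i3 : Integrable fun x => deriv φ x ^ 2 / 2 + p x / 2 * φ x ^ 2
        + 3 * k * v x ^ 2 * φ x ^ 2 := ic _ (by fun_prop) fun x hx => by simp [hz x hx]
    have i4 : Integrable fun x => 2 * k * v x * φ x ^ 3 :=
      ic _ (by fun_prop) fun x hx => by simp [hz x hx]
    have i5 : Integrable fun x => k / 2 * φ x ^ 4 :=
      ic _ (by fun_prop) fun x hx => by simp [hz x hx]
    have key := eq_zero_of_forall_quartic_nonneg
      (A := ∫ x, (g x * deriv φ x + (2 * k * v x ^ 3 + p x * v x + q x) * φ x))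
      (B := ∫ x, (deriv φ x ^ 2 / 2 + p x / 2 * φ x ^ 2 + 3 * k * v x ^ 2 * φ x ^ 2))
      (C := ∫ x, (2 * k * v x * φ x ^ 3)) (D := ∫ x, (k / 2 * φ x ^ 4)) fun t => by
        have := hmin (fun x => t * φ x) (contDiff_const.mul hφ) hc.mul_left
        simp only [← integral_const_mul]
        have j1 : Integrable fun x =>
            t * (g x * deriv φ x + (2 * k * v x ^ 3 + p x * v x + q x) * φ x) :=
          (i1.add i2).const_mul t
        have j2 := j1.add (i3.const_mul (t ^ 2))
        rw [← integral_add' j1 (i3.const_mul _), ← integral_add' j2 (i4.const_mul _),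
          ← integral_add' (j2.add (i4.const_mul _)) (i5.const_mul _)]
        convert this using 3 with x
        rw [deriv_const_mul _ (hφ.differentiable (by simp) x)]
        simp only [Pi.add_apply]
        ring
    rw [integral_add i1 i2] at key
    linarith
  -- Bootstrap: `g` has a continuous weak derivative, so it agrees almost everywhere with a `C¹`
  -- function `v₁`; then the continuous `v` is a primitive of `v₁`.
  obtain ⟨c, hc⟩ := ae_eq_primitive_of_weakDeriv hg hhc.locallyIntegrable weak
  set v₁ : ℝ → ℝ := fun x => c + ∫ t in (0 : ℝ)..x, (2 * k * v t ^ 3 + p t * v t + q t) with hv₁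
  have hd1 : ∀ x, HasDerivAt v₁ (2 * k * v x ^ 3 + p x * v x + q x) x := fun x =>
    (hhc.integral_hasStrictDerivAt _ _).hasDerivAt.const_add c
  have hv₁c : Continuous v₁ := continuous_iff_continuousAt.2 fun x => (hd1 x).continuousAt
  obtain ⟨d, hd⟩ := ae_eq_primitive_of_weakDeriv hv.locallyIntegrable hv₁c.locallyIntegrable
    fun φ hφ hφc => by
      rw [hw φ hφ hφc]
      exact congrArg _ (integral_congr_ae (hc.mul (ae_eq_refl φ)))
  have hd2 : ∀ x, HasDerivAt (fun x => d + ∫ t in (0 : ℝ)..x, v₁ t) (v₁ x) x := fun x =>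
    (hv₁c.integral_hasStrictDerivAt _ _).hasDerivAt.const_add d
  have he := (Continuous.ae_eq_iff_eq volume hv
    (continuous_iff_continuousAt.2 fun x => (hd2 x).continuousAt)).1 hd
  exact ⟨v₁, hc, fun x => by rw [he]; exact hd2 x, hd1⟩

theorem integral_comp_add_mul_left {F : ℝ → ℝ} (ξ : ℝ) {l : ℝ} (hl : 0 < l) :
    ∫ s, F (ξ + l * s) = l⁻¹ * ∫ x, F x := by
  rw [Measure.integral_comp_mul_left (fun y => F (ξ + y)) l, integral_add_left_eq_self,
    abs_of_pos (inv_pos.2 hl), smul_eq_mul]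

/-- The rescaled minimizer solves a perturbed second Painlevé equation and minimizes the
corresponding energy locally. -/
theorem IsGlobalMinimizer.rescale {μ f v : ℝ → ℝ} {a ε : ℝ} (hμ : Continuous μ)
    (hμb : ∃ M : ℝ, ∀ x, |μ x| ≤ M) (hf : Integrable f) (hfc : Continuous f)
    (h : IsGlobalMinimizer μ f a ε v) (hε : 0 < ε) (ξ : ℝ) {m l c : ℝ} (hm : 0 < m) (hl : 0 < l)
    (hc : 0 < c) (hcl : c * l = √2 * ε) (hlm : l ^ 3 * m = ε ^ 2) {w p q : ℝ → ℝ}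
    (hw : ∀ s, w s = c⁻¹ * v (ξ + l * s)) (hp : ∀ s, p s = -μ (ξ + l * s) / (m * l))
    (hq : ∀ s, q s = -(a * f (ξ + l * s)) / (√2 * m)) :
    ∃ w₁ : ℝ → ℝ, (∀ s, HasDerivAt w (w₁ s) s) ∧
      (∀ s, HasDerivAt w₁ (2 * w s ^ 3 + p s * w s + q s) s) ∧
      ∀ φ : ℝ → ℝ, ContDiff ℝ ∞ φ → HasCompactSupport φ →
        0 ≤ ∫ s, (w₁ s * deriv φ s + deriv φ s ^ 2 / 2 + p s / 2 * (2 * w s * φ s + φ s ^ 2)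
          + 1 / 2 * ((w s + φ s) ^ 4 - w s ^ 4) + q s * φ s) := by
  have hv : Continuous v := h.1
  obtain ⟨g, hg, hgw, hmin⟩ := h.exists_variation_nonneg hμ hμb hf
  obtain ⟨v₁, hgv, hv1, hv2⟩ := exists_hasDerivAt_of_variation_nonneg (k := 1 / (2 * ε ^ 2))
    (p := fun x => -μ x / ε ^ 2) (q := fun x => -(a * f x) / ε) hv hg (by fun_prop) (by fun_prop)
    hgw fun φ hφ hφc => by
      have := mul_nonneg (inv_nonneg.2 hε.le) (hmin φ hφ hφc)
      rw [← integral_const_mul] at this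
      refine this.trans_eq (integral_congr_ae (Eventually.of_forall fun x => ?_))
      field_simp
      ring
  have hs2 : √2 ^ 2 = (2 : ℝ) := Real.sq_sqrt (by norm_num)
  have hs0 : 0 < √(2 : ℝ) := by positivity
  have hc2 : c ^ 2 * l ^ 2 = 2 * ε ^ 2 := by rw [← mul_pow, hcl, mul_pow, hs2]
  have hcm : √2 * m * l ^ 2 = ε * c := by
    have : l * (√2 * m * l ^ 2) = l * (ε * c) := by linear_combination √2 * hlm - ε * hcl
    exact mul_left_cancel₀ hl.ne' this
  have haff : ∀ s, HasDerivAt (fun s => ξ + l * s) l s := fun s => by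
    simpa using ((hasDerivAt_id s).const_mul l).const_add ξ
  have hwf : w = fun s => c⁻¹ * v (ξ + l * s) := funext hw
  refine ⟨fun s => c⁻¹ * (v₁ (ξ + l * s) * l), fun s => ?_, fun s => ?_, fun φ hφ hφc => ?_⟩
  · rw [hwf]
    exact ((hv1 (ξ + l * s)).comp s (haff s)).const_mul _
  · refine ((((hv2 (ξ + l * s)).comp s (haff s)).mul_const l).const_mul c⁻¹).congr_deriv ?_
    rw [hw, hp, hq]
    have e1 : c⁻¹ * l * l * (1 / ε ^ 2) = 2 * c⁻¹ ^ 3 := by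
      field_simp; linear_combination hc2
    have e2 : c⁻¹ * l * l / ε ^ 2 = c⁻¹ / (m * l) := by
      field_simp; linear_combination hlm
    have e3 : c⁻¹ * l * l / ε = 1 / (√2 * m) := by
      field_simp; linear_combination hcm
    have t1 : c⁻¹ * ((2 * (1 / (2 * ε ^ 2)) * v (ξ + l * s) ^ 3
        + -μ (ξ + l * s) / ε ^ 2 * v (ξ + l * s) + -(a * f (ξ + l * s)) / ε) * l * l)
        = (c⁻¹ * l * l * (1 / ε ^ 2)) * v (ξ + l * s) ^ 3
        - (c⁻¹ * l * l / ε ^ 2) * (μ (ξ + l * s) * v (ξ + l * s))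
        - (c⁻¹ * l * l / ε) * (a * f (ξ + l * s)) := by ring
    rw [t1, e1, e2, e3]
    ring
  -- A variation `φ` of `w` corresponds to this variation of `v`.
  · have h1 := hmin (fun x => c * φ (l⁻¹ * (x - ξ)))
      (contDiff_const.mul (hφ.comp (contDiff_const.mul (contDiff_id.sub contDiff_const)))) (by
        refine HasCompactSupport.mul_left ?_
        exact hφc.comp_homeomorph
          ((Homeomorph.subRight ξ).trans (Homeomorph.mulLeft₀ l⁻¹ (inv_ne_zero hl.ne'))))
    have hd : ∀ x, deriv (fun x => c * φ (l⁻¹ * (x - ξ))) x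
        = c * (deriv φ (l⁻¹ * (x - ξ)) * l⁻¹) := fun x => by
      have ha : HasDerivAt (fun x : ℝ => l⁻¹ * (x - ξ)) l⁻¹ x := by
        simpa using ((hasDerivAt_id x).sub_const ξ).const_mul l⁻¹
      exact ((((hφ.differentiable (by simp)) _).hasDerivAt.comp x ha).const_mul c).deriv
    rw [integral_congr_ae (g := fun x => (ε / 2 * (2 * v₁ x * (c * (deriv φ (l⁻¹ * (x - ξ)) * l⁻¹))
        + (c * (deriv φ (l⁻¹ * (x - ξ)) * l⁻¹)) ^ 2)
          - 1 / (2 * ε) * μ x * (2 * v x * (c * φ (l⁻¹ * (x - ξ))) + (c * φ (l⁻¹ * (x - ξ))) ^ 2)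
          + 1 / (4 * ε) * ((v x + c * φ (l⁻¹ * (x - ξ))) ^ 4 - v x ^ 4)
          - a * f x * (c * φ (l⁻¹ * (x - ξ))))) (by
        filter_upwards [hgv] with x hx
        rw [hd, hx])] at h1
    have h2 := mul_nonneg (inv_nonneg.2 hl.le) h1
    rw [← integral_comp_add_mul_left ξ hl] at h2
    -- This factor brings the gradient term to the coefficient `1 / 2`; `k1` to `k4` then match the
    -- remaining coefficients.
    have h3 := mul_nonneg (a := l ^ 2 / (ε * c ^ 2)) (by positivity) h2
    rw [← integral_const_mul] at h3
    refine h3.trans_eq (integral_congr_ae (Eventually.of_forall fun s => ?_))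
    beta_reduce
    have e0 : l⁻¹ * (ξ + l * s - ξ) = s := by field_simp; ring
    rw [e0, hw, hp, hq]
    have k1 : l ^ 2 / (ε * c ^ 2) * (1 / (2 * ε)) * c ^ 2 = 1 / (2 * (m * l)) := by
      field_simp; linear_combination hlm
    have k2 : l ^ 2 / (ε * c ^ 2) * (1 / (4 * ε)) * c ^ 4 = 1 / 2 := by
      field_simp; linear_combination 2 * hc2
    have k3 : l ^ 2 / (ε * c ^ 2) * c = 1 / (√2 * m) := by
      field_simp; linear_combination hcm
    have k4 : l ^ 2 / (ε * c ^ 2) * (ε / 2) * (c ^ 2 * l⁻¹ ^ 2) = 1 / 2 := by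
      field_simp
    have hV : v (ξ + l * s) = c * (c⁻¹ * v (ξ + l * s)) := by field_simp
    have hV1 : v₁ (ξ + l * s) = c * l⁻¹ * (c⁻¹ * (v₁ (ξ + l * s) * l)) := by field_simp
    generalize c⁻¹ * v (ξ + l * s) = W at *
    generalize c⁻¹ * (v₁ (ξ + l * s) * l) = W₁ at *
    rw [hV, hV1]
    linear_combination (2 * W₁ * deriv φ s + deriv φ s ^ 2) * k4
      - μ (ξ + l * s) * (2 * W * φ s + φ s ^ 2) * k1
      + ((W + φ s) ^ 4 - W ^ 4) * k2 - a * f (ξ + l * s) * φ s * k3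

/-! ### A priori bounds from the cubic term. -/

/-- An interior a priori bound of Keller-Osserman type: a solution of `w'' ≥ w³` wherever `w ≥ K`
on an interval of radius one is at most `K` at its centre. -/
theorem le_of_cube_le_deriv_deriv {w w₁ w₂ : ℝ → ℝ} {s K : ℝ} (h1 : ∀ t, HasDerivAt w (w₁ t) t)
    (h2 : ∀ t, HasDerivAt w₁ (w₂ t) t) (hK : 3 ≤ K)
    (h : ∀ t, |t - s| ≤ 1 → K ≤ w t → w t ^ 3 ≤ w₂ t) : w s ≤ K := by
  -- The cutoff `b = 1 - (t - s)²` vanishes at the ends of the interval, so if `w s > K` then `H`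
  -- has an interior maximum with value above `K`.
  set H : ℝ → ℝ := fun t => w t * (1 - (t - s) ^ 2) with hH
  have hb : ∀ t, HasDerivAt (fun t : ℝ => 1 - (t - s) ^ 2) (-(2 * (t - s))) t := fun t => by
    simpa using (((hasDerivAt_id t).sub_const s).pow 2).const_sub 1
  have hd : ∀ t, HasDerivAt H (w₁ t * (1 - (t - s) ^ 2) + w t * -(2 * (t - s))) t := fun t =>
    (h1 t).mul (hb t)
  have hdf : deriv H = fun t => w₁ t * (1 - (t - s) ^ 2) + w t * -(2 * (t - s)) :=
    funext fun t => (hd t).deriv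
  have hdd : ∀ t, HasDerivAt (deriv H)
      (w₂ t * (1 - (t - s) ^ 2) + w₁ t * -(2 * (t - s)) + (w₁ t * -(2 * (t - s)) + w t * -2)) t := by
    intro t
    rw [hdf]
    refine ((h2 t).mul (hb t)).add ((h1 t).mul ?_)
    exact (((hasDerivAt_id t).sub_const s).const_mul 2).neg.congr_deriv (by simp)
  have hHc : Continuous H := continuous_iff_continuousAt.2 fun t => (hd t).continuousAt
  obtain ⟨t, ht, hmax⟩ := (isCompact_Icc (a := s - 1) (b := s + 1)).exists_isMaxOn
    ⟨s, by constructor <;> linarith⟩ hHc.continuousOn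
  have hs : w s ≤ H t := by
    have := hmax (show s ∈ Set.Icc (s - 1) (s + 1) by constructor <;> linarith)
    simpa [hH] using this
  by_contra! hlt
  have hpos : K < w t * (1 - (t - s) ^ 2) := hlt.trans_le hs
  have hlo : s - 1 < t := by
    rcases ht.1.lt_or_eq with h' | h'
    · exact h'
    · rw [← h'] at hpos; norm_num at hpos; linarith
  have hhi : t < s + 1 := by
    rcases ht.2.lt_or_eq with h' | h'
    · exact h'
    · rw [h'] at hpos; norm_num at hpos; linarith
  have hloc : IsLocalMax H t := hmax.isLocalMax (Icc_mem_nhds hlo hhi)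
  have hd0 : deriv H t = 0 := hloc.deriv_eq_zero
  have hbpos : 0 < 1 - (t - s) ^ 2 := by nlinarith
  have hble : 1 - (t - s) ^ 2 ≤ 1 := by nlinarith [sq_nonneg (t - s)]
  have hwK : K < w t := by
    by_contra! hle
    nlinarith
  have hw2 := h t (abs_le.2 ⟨by linarith, by linarith⟩) hwK.le
  have hE : w₁ t * (1 - (t - s) ^ 2) = w t * (2 * (t - s)) := by
    rw [hdf] at hd0; simp only at hd0; linarith
  have hpp : 0 < deriv (deriv H) t := by
    rw [(hdd t).deriv]
    refine pos_of_mul_pos_left (b := 1 - (t - s) ^ 2) ?_ hbpos.le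
    have hu : (t - s) ^ 2 = 1 - (1 - (t - s) ^ 2) := by ring
    -- Multiplying `H''` by `b` lets `H' = 0` eliminate `w₁`. The negative terms amount to `w (8 - 6
    -- b) ≤ 8 w`, while `w³ b² = w H² > 9 w` since `H > K ≥ 3`.
    have e : (w₂ t * (1 - (t - s) ^ 2) + w₁ t * -(2 * (t - s))
        + (w₁ t * -(2 * (t - s)) + w t * -2)) * (1 - (t - s) ^ 2)
        = w₂ t * (1 - (t - s) ^ 2) ^ 2 - 8 * (t - s) ^ 2 * w t - 2 * w t * (1 - (t - s) ^ 2) := by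
      linear_combination (-4 * (t - s)) * hE
    rw [e]
    have e1 : w t ^ 3 * (1 - (t - s) ^ 2) ^ 2 ≤ w₂ t * (1 - (t - s) ^ 2) ^ 2 := by gcongr
    have e2 : 9 < (w t * (1 - (t - s) ^ 2)) ^ 2 := by nlinarith
    have e3 : 0 < w t * ((w t * (1 - (t - s) ^ 2)) ^ 2 - 9) :=
      mul_pos (by linarith) (by linarith)
    have e4 : 0 < w t * (1 - (t - s) ^ 2) := by linarith
    nlinarith
  have hmin : IsLocalMin H t := isLocalMin_of_deriv_deriv_pos hpp hd0 hHc.continuousAt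
  have hconst : H =ᶠ[𝓝 t] fun _ => H t := by
    filter_upwards [hloc, hmin] with r hr1 hr2 using le_antisymm hr1 hr2
  have := hconst.deriv.deriv_eq
  simp at this
  linarith

/-- Two-sided form of the a priori bound for `w'' = 2 w³ + p w + q`. -/
theorem abs_le_of_perturbed_painleve {w w₁ p q : ℝ → ℝ} {s P Q : ℝ}
    (h1 : ∀ t, HasDerivAt w (w₁ t) t)
    (h2 : ∀ t, HasDerivAt w₁ (2 * w t ^ 3 + p t * w t + q t) t) (hP0 : 0 ≤ P)
    (hP : ∀ t, |t - s| ≤ 1 → -P ≤ p t) (hQ : ∀ t, |t - s| ≤ 1 → |q t| ≤ Q) :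
    |w s| ≤ 3 + P + Q := by
  have hQ0 : 0 ≤ Q := (abs_nonneg _).trans (hQ s (by simp))
  -- Above this threshold `x² ≥ P + Q` and `x ≥ 1`, so one copy of `x³` absorbs `P x + Q`.
  have key : ∀ x p' q' : ℝ, -P ≤ p' → |q'| ≤ Q → 3 + P + Q ≤ x →
      x ^ 3 ≤ 2 * x ^ 3 + p' * x + q' := by
    intro x p' q' hp hq hx
    have h1 := (abs_le.1 hq).1
    have h2 : -P * x ≤ p' * x := mul_le_mul_of_nonneg_right hp (by linarith)
    have h3 : (P + Q) * x ≤ x ^ 2 * x := by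
      apply mul_le_mul_of_nonneg_right _ (by linarith)
      nlinarith
    nlinarith
  rw [abs_le]
  constructor
  · have := le_of_cube_le_deriv_deriv (w := fun t => -w t) (s := s) (K := 3 + P + Q)
      (fun t => (h1 t).neg) (fun t => (h2 t).neg) (by linarith) fun t ht hK => by
        have := key (-w t) (p t) (-q t) (hP t ht) (by rw [abs_neg]; exact hQ t ht) hK
        linarith
    linarith
  · exact le_of_cube_le_deriv_deriv h1 h2 (by linarith) fun t ht hK =>
      key _ _ _ (hP t ht) (hQ t ht) hK

/-- Every solution of the second Painlevé equation on the line is bounded near `+∞`. -/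
theorem boundedAtTop_of_painleve {y y₁ : ℝ → ℝ} {α : ℝ} (h1 : ∀ t, HasDerivAt y (y₁ t) t)
    (h2 : ∀ t, HasDerivAt y₁ (2 * y t ^ 3 + t * y t + α) t) : BoundedAtTop y := by
  refine ⟨3 + 0 + |α|, ?_⟩
  filter_upwards [eventually_ge_atTop 1] with s hs
  -- For `s ≥ 1` the unit interval around `s` lies in `t ≥ 0`, so `P = 0` is admissible.
  refine abs_le_of_perturbed_painleve (p := fun t => t) (q := fun _ => α) h1 h2 le_rfl
    (fun t ht => ?_) fun _ _ => le_rfl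
  have := (abs_le.1 ht).1
  linarith

/-! ### Grönwall estimates for second-order equations. -/

/-- Grönwall's inequality for `|d''| ≤ L |d| + δ` on `[0, R]`. -/
theorem abs_le_exp_of_deriv_deriv_le_right {d d₁ e : ℝ → ℝ} {R L δ η : ℝ} (hL : 0 ≤ L) (hδ : 0 ≤ δ)
    (h1 : ∀ t, HasDerivAt d (d₁ t) t) (h2 : ∀ t, HasDerivAt d₁ (e t) t)
    (he : ∀ t ∈ Set.Icc 0 R, |e t| ≤ L * |d t| + δ) (h0 : |d 0| ≤ η) (h0' : |d₁ 0| ≤ η) :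
    ∀ t ∈ Set.Icc 0 R, |d t| ≤ (η + δ) * Real.exp ((1 + L) * R) ∧
      |d₁ t| ≤ (η + δ) * Real.exp ((1 + L) * R) := by
  have hD : ∀ t, HasDerivAt (fun t => (d t, d₁ t)) (d₁ t, e t) t := fun t => (h1 t).prodMk (h2 t)
  have hη : 0 ≤ η := (abs_nonneg _).trans h0
  intro t ht
  -- The first-order system for `(d, d₁)` in the sup norm; the constant `1 + L` serves both
  -- components and is never zero.
  have key := norm_le_gronwallBound_of_norm_deriv_right_le (f := fun t => (d t, d₁ t))
    (f' := fun t => (d₁ t, e t)) (δ := η) (K := 1 + L) (ε := δ) (a := 0) (b := R)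
    (fun t _ => (hD t).continuousAt.continuousWithinAt) (fun t _ => (hD t).hasDerivWithinAt)
    (by simp [Prod.norm_def, h0, h0']) (fun t ht => by
      have := he t ⟨ht.1, ht.2.le⟩
      simp only [Prod.norm_def, Real.norm_eq_abs]
      have m1 := le_max_left |d t| |d₁ t|
      have m2 := le_max_right |d t| |d₁ t|
      have m3 := abs_nonneg (d t)
      have m4 := mul_le_mul_of_nonneg_left m1 hL
      have m5 : 0 ≤ L * max |d t| |d₁ t| := by positivity
      refine max_le ?_ ?_ <;> linarith) t ht
  have hb : gronwallBound η (1 + L) δ (t - 0) ≤ (η + δ) * Real.exp ((1 + L) * R) := by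
    rw [gronwallBound_of_K_ne_0 (by linarith)]
    have e1 : Real.exp ((1 + L) * (t - 0)) ≤ Real.exp ((1 + L) * R) := by
      apply Real.exp_le_exp.2
      apply mul_le_mul_of_nonneg_left _ (by linarith)
      linarith [ht.2]
    have e2 : δ / (1 + L) ≤ δ := div_le_self hδ (by linarith)
    have e3 : 0 ≤ Real.exp ((1 + L) * (t - 0)) - 1 := by
      have : 0 ≤ (1 + L) * (t - 0) := mul_nonneg (by linarith) (by linarith [ht.1])
      linarith [Real.one_le_exp this]
    have e4 := mul_le_mul_of_nonneg_right e2 e3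
    have e5 := mul_le_mul_of_nonneg_left e1 hη
    have e6 := mul_le_mul_of_nonneg_left e1 hδ
    simp only
    linarith
  have hn := key.trans hb
  simp only [Prod.norm_def, Real.norm_eq_abs] at hn
  exact max_le_iff.1 hn

theorem abs_le_exp_of_deriv_deriv_le {d d₁ e : ℝ → ℝ} {R L δ η : ℝ} (hL : 0 ≤ L) (hδ : 0 ≤ δ)
    (h1 : ∀ t, HasDerivAt d (d₁ t) t) (h2 : ∀ t, HasDerivAt d₁ (e t) t)
    (he : ∀ t, |t| ≤ R → |e t| ≤ L * |d t| + δ) (h0 : |d 0| ≤ η) (h0' : |d₁ 0| ≤ η) :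
    ∀ t, |t| ≤ R → |d t| ≤ (η + δ) * Real.exp ((1 + L) * R) ∧
      |d₁ t| ≤ (η + δ) * Real.exp ((1 + L) * R) := by
  intro t ht
  rcases le_total 0 t with h | h
  · exact abs_le_exp_of_deriv_deriv_le_right hL hδ h1 h2
      (fun t ht => he t (abs_le.2 ⟨by linarith [ht.1, ht.2], ht.2⟩)) h0 h0' t ⟨h, (abs_le.1 ht).2⟩
  · have := abs_le_exp_of_deriv_deriv_le_right (d := fun t => d (-t)) (d₁ := fun t => -d₁ (-t))
      (e := fun t => e (-t)) (R := R) (η := η) hL hδ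
      (fun t => ((h1 (-t)).comp t (hasDerivAt_neg t)).congr_deriv (by simp))
      (fun t => ((h2 (-t)).comp t (hasDerivAt_neg t)).neg.congr_deriv (by simp))
      (fun t ht => he (-t) (by rw [abs_neg]; exact abs_le.2 ⟨by linarith [ht.1, ht.2], ht.2⟩))
      (by simpa using h0) (by simpa using h0') (-t) ⟨by linarith, by linarith [(abs_le.1 ht).1]⟩
    simpa using this

/-! ### Locally uniform convergence. -/

theorem tendstoLocallyUniformly_iff_abs_le {F : ℕ → ℝ → ℝ} {f : ℝ → ℝ} :
    TendstoLocallyUniformly F f atTop ↔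
      ∀ R η : ℝ, 0 < η → ∀ᶠ n in atTop, ∀ s, |s| ≤ R → |F n s - f s| ≤ η := by
  rw [tendstoLocallyUniformly_iff_forall_isCompact]
  constructor
  · intro h R η hη
    have := Metric.tendstoUniformlyOn_iff.1 (h (Metric.closedBall 0 R) (isCompact_closedBall 0 R))
      η hη
    filter_upwards [this] with n hn s hs
    have := hn s (by simpa using hs)
    rw [dist_comm, Real.dist_eq] at this
    exact this.le
  · intro h K hK
    obtain ⟨R, hR⟩ := hK.isBounded.subset_closedBall 0
    rw [Metric.tendstoUniformlyOn_iff]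
    intro η hη
    filter_upwards [h R (η / 2) (half_pos hη)] with n hn s hs
    have := hn s (by simpa using hR hs)
    rw [dist_comm, Real.dist_eq]
    linarith

theorem TendstoLocallyUniformly.comp_strictMono {F : ℕ → ℝ → ℝ} {f : ℝ → ℝ} {φ : ℕ → ℕ}
    (h : TendstoLocallyUniformly F f atTop) (hφ : StrictMono φ) :
    TendstoLocallyUniformly (fun n => F (φ n)) f atTop := fun u hu x => by
  obtain ⟨t, ht, h⟩ := h u hu x
  exact ⟨t, ht, hφ.tendsto_atTop.eventually h⟩

theorem TendstoLocallyUniformly.tendsto_apply {F : ℕ → ℝ → ℝ} {f : ℝ → ℝ}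
    (h : TendstoLocallyUniformly F f atTop) (s : ℝ) :
    Tendsto (fun n => F n s) atTop (𝓝 (f s)) :=
  (tendstoLocallyUniformlyOn_univ.2 h).tendsto_at (Set.mem_univ s)

theorem tendstoLocallyUniformly_of_cauchy {F : ℕ → ℝ → ℝ} {f : ℝ → ℝ}
    (hc : ∀ R η : ℝ, 0 < η → ∃ N, ∀ m ≥ N, ∀ n ≥ N, ∀ s, |s| ≤ R → |F m s - F n s| ≤ η)
    (hl : ∀ s, Tendsto (fun n => F n s) atTop (𝓝 (f s))) : TendstoLocallyUniformly F f atTop := by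
  rw [tendstoLocallyUniformly_iff_abs_le]
  intro R η hη
  obtain ⟨N, hN⟩ := hc R η hη
  filter_upwards [eventually_ge_atTop N] with n hn s hs
  refine le_of_tendsto (tendsto_const_nhds.sub (hl s)).abs ?_
  filter_upwards [eventually_ge_atTop N] with m hm using hN n hn m hm s hs

theorem exists_tendsto_of_cauchy {F : ℕ → ℝ → ℝ}
    (hc : ∀ R η : ℝ, 0 < η → ∃ N, ∀ m ≥ N, ∀ n ≥ N, ∀ s, |s| ≤ R → |F m s - F n s| ≤ η) :
    ∃ f : ℝ → ℝ, ∀ s, Tendsto (fun n => F n s) atTop (𝓝 (f s)) := by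
  have : ∀ s, ∃ l, Tendsto (fun n => F n s) atTop (𝓝 l) := fun s => by
    apply cauchySeq_tendsto_of_complete
    rw [Metric.cauchySeq_iff]
    intro η hη
    obtain ⟨N, hN⟩ := hc |s| (η / 2) (half_pos hη)
    refine ⟨N, fun m hm n hn => ?_⟩
    rw [Real.dist_eq]
    linarith [hN m hm n hn s le_rfl]
  choose f hf using this
  exact ⟨f, hf⟩

/-! ### Compactness for perturbed Painlevé equations. -/

section Compactness

variable {w w₁ p q : ℕ → ℝ → ℝ} {α : ℝ}

theorem eventually_abs_le_of_perturbed_painleve (h1 : ∀ n t, HasDerivAt (w n) (w₁ n t) t)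
    (h2 : ∀ n t, HasDerivAt (w₁ n) (2 * w n t ^ 3 + p n t * w n t + q n t) t)
    (hp : TendstoLocallyUniformly p (fun s => s) atTop)
    (hq : TendstoLocallyUniformly q (fun _ => α) atTop) (R : ℝ) :
    ∃ K, 0 ≤ K ∧ ∀ᶠ n in atTop, ∀ s, |s| ≤ R → |w n s| ≤ K ∧ |p n s| ≤ K ∧ |q n s| ≤ K := by
  rw [tendstoLocallyUniformly_iff_abs_le] at hp hq
  -- The local bound at `|s| ≤ R` looks at `p` and `q` up to distance one, hence the control of both
  -- on `|t| ≤ |R| + 1`.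
  refine ⟨3 + (|R| + 2) + (|α| + 1), by positivity, ?_⟩
  filter_upwards [hp (|R| + 1) 1 one_pos, hq (|R| + 1) 1 one_pos] with n hpn hqn s hs
  have hR := le_abs_self R
  have hα := abs_nonneg α
  have bp : ∀ t, |t| ≤ |R| + 1 → |p n t| ≤ |R| + 2 := fun t ht => by
    have := abs_sub_abs_le_abs_sub (p n t) t
    linarith [hpn t ht]
  have bq : ∀ t, |t| ≤ |R| + 1 → |q n t| ≤ |α| + 1 := fun t ht => by
    have := abs_sub_abs_le_abs_sub (q n t) α
    linarith [hqn t ht]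
  have hts : ∀ t, |t - s| ≤ 1 → |t| ≤ |R| + 1 := fun t ht => by
    have := abs_sub_abs_le_abs_sub t s
    linarith
  refine ⟨abs_le_of_perturbed_painleve (h1 n) (h2 n) (by positivity)
    (fun t ht => (abs_le.1 (bp t (hts t ht))).1) fun t ht => bq t (hts t ht), ?_, ?_⟩
  · linarith [bp s (by linarith)]
  · linarith [bq s (by linarith), abs_nonneg R]

/-- By the mean value theorem `u₁` equals `u 1 - u 0` somewhere in `(0, 1)`, and from there to `0`
it changes by at most `B`. This bounds the second Cauchy datum. -/
theorem abs_deriv_zero_le {u u₁ u₂ : ℝ → ℝ} {A B : ℝ} (h1 : ∀ t, HasDerivAt u (u₁ t) t)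
    (h2 : ∀ t, HasDerivAt u₁ (u₂ t) t) (hA : ∀ t, |t| ≤ 1 → |u t| ≤ A)
    (hB : ∀ t, |t| ≤ 1 → |u₂ t| ≤ B) : |u₁ 0| ≤ 2 * A + B := by
  obtain ⟨t, ht, e⟩ := exists_hasDerivAt_eq_slope u u₁ one_pos
    (continuous_iff_continuousAt.2 fun t => (h1 t).continuousAt).continuousOn fun t _ => h1 t
  obtain ⟨r, hr, e'⟩ := exists_hasDerivAt_eq_slope u₁ u₂ ht.1
    (continuous_iff_continuousAt.2 fun t => (h2 t).continuousAt).continuousOn fun t _ => h2 t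
  have hB' := hB r (abs_le.2 ⟨by linarith [hr.1], by linarith [hr.2, ht.2]⟩)
  have e0 : u₁ 0 = u₁ t - u₂ r * t := by
    rw [e']; field_simp [ht.1.ne']; ring
  have e1 : |u₂ r * t| ≤ B := by
    rw [abs_mul, abs_of_pos ht.1]
    nlinarith [abs_nonneg (u₂ r), ht.2, ht.1]
  have a1 := abs_le.1 (hA 1 (by simp))
  have a0 := abs_le.1 (hA 0 (by simp))
  have b := abs_le.1 e1
  rw [e0, e]
  norm_num
  rw [abs_le]
  constructor <;> linarith [a1.1, a1.2, a0.1, a0.2, b.1, b.2]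

/-- Solutions of perturbed second Painlevé equations are Cauchy in `C²` on bounded sets if their
Cauchy data at `0` converge. -/
theorem cauchy_of_perturbed_painleve (h1 : ∀ n t, HasDerivAt (w n) (w₁ n t) t)
    (h2 : ∀ n t, HasDerivAt (w₁ n) (2 * w n t ^ 3 + p n t * w n t + q n t) t)
    (hp : TendstoLocallyUniformly p (fun s => s) atTop)
    (hq : TendstoLocallyUniformly q (fun _ => α) atTop) {b b₁ : ℝ}
    (hb : Tendsto (fun n => w n 0) atTop (𝓝 b)) (hb₁ : Tendsto (fun n => w₁ n 0) atTop (𝓝 b₁))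
    (R η : ℝ) (hη : 0 < η) :
    ∃ N, ∀ m ≥ N, ∀ n ≥ N, ∀ s, |s| ≤ R → |w m s - w n s| ≤ η ∧ |w₁ m s - w₁ n s| ≤ η ∧
      |(2 * w m s ^ 3 + p m s * w m s + q m s) - (2 * w n s ^ 3 + p n s * w n s + q n s)| ≤ η := by
  obtain ⟨K, hK0, hK⟩ := eventually_abs_le_of_perturbed_painleve h1 h2 hp hq R
  rw [tendstoLocallyUniformly_iff_abs_le] at hp hq
  -- `L` is a Lipschitz constant of `x ↦ 2 x³ + p x` for `|x|, |p| ≤ K`. With data within `δ` of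
  -- their limits, Grönwall gives `C δ` for the first two differences, and `D δ = η` covers all
  -- three.
  set L := 6 * K ^ 2 + K with hL
  have hL0 : 0 ≤ L := by positivity
  set C := (2 + (2 * K + 2)) * Real.exp ((1 + L) * R) with hC
  have hC0 : 0 < C := by positivity
  set D := C + L * C + (2 * K + 2) with hD
  have hD0 : 0 < D := by positivity
  set δ := η / D with hδ
  have hδ0 : 0 < δ := by positivity
  have ev0 : ∀ᶠ n in atTop, |w n 0 - b| ≤ δ := by
    filter_upwards [Metric.tendsto_nhds.1 hb δ hδ0] with n hn using (Real.dist_eq _ _ ▸ hn).le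
  have ev1 : ∀ᶠ n in atTop, |w₁ n 0 - b₁| ≤ δ := by
    filter_upwards [Metric.tendsto_nhds.1 hb₁ δ hδ0] with n hn using (Real.dist_eq _ _ ▸ hn).le
  obtain ⟨N, hN⟩ := eventually_atTop.1
    (hK.and ((hp R δ hδ0).and ((hq R δ hδ0).and (ev0.and ev1))))
  refine ⟨N, fun m hm n hn => ?_⟩
  obtain ⟨bm, pm, qm, m0, m1⟩ := hN m hm
  obtain ⟨bn, pn, qn, n0, n1⟩ := hN n hn
  have two : ∀ x y z : ℝ, |x - z| ≤ δ → |y - z| ≤ δ → |x - y| ≤ 2 * δ := fun x y z hx hy => by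
    rw [abs_le] at *; constructor <;> linarith [hx.1, hx.2, hy.1, hy.2]
  have he : ∀ s, |s| ≤ R →
      |(2 * w m s ^ 3 + p m s * w m s + q m s) - (2 * w n s ^ 3 + p n s * w n s + q n s)|
        ≤ L * |w m s - w n s| + (2 * K + 2) * δ := by
    intro s hs
    obtain ⟨x1, x2, -⟩ := bm s hs
    obtain ⟨y1, -, -⟩ := bn s hs
    have e : (2 * w m s ^ 3 + p m s * w m s + q m s) - (2 * w n s ^ 3 + p n s * w n s + q n s)
        = (2 * (w m s ^ 2 + w m s * w n s + w n s ^ 2) + p m s) * (w m s - w n s)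
          + ((p m s - p n s) * w n s + (q m s - q n s)) := by ring
    rw [e]
    have f1 : |2 * (w m s ^ 2 + w m s * w n s + w n s ^ 2) + p m s| ≤ L := by
      have g1 : |w m s ^ 2| ≤ K ^ 2 := by rw [abs_pow]; gcongr
      have g2 : |w n s ^ 2| ≤ K ^ 2 := by rw [abs_pow]; gcongr
      have g3 : |w m s * w n s| ≤ K ^ 2 := by rw [abs_mul, sq]; gcongr
      rw [abs_le] at g1 g2 g3 x2 ⊢
      constructor <;> linarith [g1.1, g1.2, g2.1, g2.2, g3.1, g3.2, x2.1, x2.2]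
    have f2 : |(p m s - p n s) * w n s| ≤ 2 * δ * K := by
      rw [abs_mul]; gcongr; exact two _ _ _ (pm s hs) (pn s hs)
    have f3 : |q m s - q n s| ≤ 2 * δ := two _ _ _ (qm s hs) (qn s hs)
    have f4 : |(2 * (w m s ^ 2 + w m s * w n s + w n s ^ 2) + p m s) * (w m s - w n s)|
        ≤ L * |w m s - w n s| := by rw [abs_mul]; gcongr
    refine (abs_add_le _ _).trans ?_
    have := abs_add_le ((p m s - p n s) * w n s) (q m s - q n s)
    linarith
  have key := abs_le_exp_of_deriv_deriv_le (d := fun t => w m t - w n t)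
    (d₁ := fun t => w₁ m t - w₁ n t) (η := 2 * δ) hL0 (by positivity)
    (fun t => (h1 m t).sub (h1 n t)) (fun t => (h2 m t).sub (h2 n t)) he
    (two _ _ _ m0 n0) (two _ _ _ m1 n1)
  have hCδ : (2 * δ + (2 * K + 2) * δ) * Real.exp ((1 + L) * R) = C * δ := by rw [hC]; ring
  have hDδ : D * δ = η := by rw [hδ]; field_simp
  rw [hCδ] at key
  have hLC : 0 ≤ L * C * δ := by positivity
  have hKδ : 0 ≤ (2 * K + 2) * δ := by positivity
  have hCδ0 : 0 ≤ C * δ := by positivity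
  have hsum : C * δ + L * C * δ + (2 * K + 2) * δ = η := by rw [← hDδ, hD]; ring
  intro s hs
  obtain ⟨k0, k1⟩ := key s hs
  refine ⟨by linarith, by linarith, (he s hs).trans ?_⟩
  have := mul_le_mul_of_nonneg_left k0 hL0
  linarith

/-- Bolzano-Weierstrass is needed only for the pair of Cauchy data at `0`; continuous dependence
does the rest. Uniform convergence of `w''` as well identifies the derivative of `y₁`. -/
theorem exists_subseq_tendsto_of_perturbed_painleve (h1 : ∀ n t, HasDerivAt (w n) (w₁ n t) t)
    (h2 : ∀ n t, HasDerivAt (w₁ n) (2 * w n t ^ 3 + p n t * w n t + q n t) t)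
    (hp : TendstoLocallyUniformly p (fun s => s) atTop)
    (hq : TendstoLocallyUniformly q (fun _ => α) atTop) :
    ∃ φ : ℕ → ℕ, StrictMono φ ∧ ∃ y y₁ : ℝ → ℝ,
      TendstoLocallyUniformly (fun n => w (φ n)) y atTop ∧
      TendstoLocallyUniformly (fun n => w₁ (φ n)) y₁ atTop ∧
      (∀ t, HasDerivAt y (y₁ t) t) ∧ ∀ t, HasDerivAt y₁ (2 * y t ^ 3 + t * y t + α) t := by
  obtain ⟨K, hK0, hK⟩ := eventually_abs_le_of_perturbed_painleve h1 h2 hp hq 1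
  have hbd : ∀ᶠ n in atTop, (w n 0, w₁ n 0) ∈
      Metric.closedBall (0 : ℝ × ℝ) (2 * K + (2 * K ^ 3 + K * K + K)) := by
    filter_upwards [hK] with n hn
    rw [mem_closedBall_zero_iff, Prod.norm_def]
    refine max_le ?_ ?_
    · have := (hn 0 (by simp)).1
      have : 0 ≤ 2 * K ^ 3 + K * K + K := by positivity
      simp only [Real.norm_eq_abs]
      linarith
    · refine abs_deriv_zero_le (h1 n) (h2 n) (fun t ht => (hn t ht).1) fun t ht => ?_
      obtain ⟨a1, a2, a3⟩ := hn t ht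
      have c1 : |2 * w n t ^ 3| ≤ 2 * K ^ 3 := by
        rw [abs_mul, abs_pow, abs_of_pos two_pos]; gcongr
      have c2 : |p n t * w n t| ≤ K * K := by rw [abs_mul]; gcongr
      have c3 := abs_add_le (2 * w n t ^ 3 + p n t * w n t) (q n t)
      have c4 := abs_add_le (2 * w n t ^ 3) (p n t * w n t)
      linarith
  obtain ⟨x, -, φ, hφ, hx⟩ := tendsto_subseq_of_frequently_bounded Metric.isBounded_closedBall
    hbd.frequently
  have hpφ := hp.comp_strictMono hφ
  have hqφ := hq.comp_strictMono hφ
  have hc := cauchy_of_perturbed_painleve (w := fun n => w (φ n)) (w₁ := fun n => w₁ (φ n))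
    (fun n => h1 (φ n)) (fun n => h2 (φ n)) hpφ hqφ
    ((continuous_fst.tendsto x).comp hx) ((continuous_snd.tendsto x).comp hx)
  have c0 : ∀ R η : ℝ, 0 < η → ∃ N, ∀ m ≥ N, ∀ n ≥ N, ∀ s, |s| ≤ R →
      |w (φ m) s - w (φ n) s| ≤ η := fun R η hη => by
    obtain ⟨N, hN⟩ := hc R η hη
    exact ⟨N, fun m hm n hn s hs => (hN m hm n hn s hs).1⟩
  have c1 : ∀ R η : ℝ, 0 < η → ∃ N, ∀ m ≥ N, ∀ n ≥ N, ∀ s, |s| ≤ R →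
      |w₁ (φ m) s - w₁ (φ n) s| ≤ η := fun R η hη => by
    obtain ⟨N, hN⟩ := hc R η hη
    exact ⟨N, fun m hm n hn s hs => (hN m hm n hn s hs).2.1⟩
  obtain ⟨y, hy⟩ := exists_tendsto_of_cauchy (F := fun n => w (φ n)) c0
  obtain ⟨y₁, hy₁⟩ := exists_tendsto_of_cauchy (F := fun n => w₁ (φ n)) c1
  have t0 := tendstoLocallyUniformly_of_cauchy (F := fun n => w (φ n)) c0 hy
  have t1 := tendstoLocallyUniformly_of_cauchy (F := fun n => w₁ (φ n)) c1 hy₁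
  have hpt : ∀ s, Tendsto (fun n => p (φ n) s) atTop (𝓝 s) := fun s => hpφ.tendsto_apply s
  have hqt : ∀ s, Tendsto (fun n => q (φ n) s) atTop (𝓝 α) := fun s => hqφ.tendsto_apply s
  have t2 := tendstoLocallyUniformly_of_cauchy
    (F := fun n s => 2 * w (φ n) s ^ 3 + p (φ n) s * w (φ n) s + q (φ n) s)
    (f := fun s => 2 * y s ^ 3 + s * y s + α) (fun R η hη => by
      obtain ⟨N, hN⟩ := hc R η hη
      exact ⟨N, fun m hm n hn s hs => (hN m hm n hn s hs).2.2⟩)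
    fun s => ((((hy s).pow 3).const_mul 2).add ((hpt s).mul (hy s))).add (hqt s)
  refine ⟨φ, hφ, y, y₁, t0, t1, fun t => ?_, fun t => ?_⟩
  · exact hasDerivAt_of_tendstoLocallyUniformlyOn isOpen_univ
      (tendstoLocallyUniformlyOn_univ.2 t1) (Eventually.of_forall fun n x _ => h1 (φ n) x)
      (fun x _ => hy x) (Set.mem_univ t)
  · exact hasDerivAt_of_tendstoLocallyUniformlyOn isOpen_univ
      (tendstoLocallyUniformlyOn_univ.2 t2) (Eventually.of_forall fun n x _ => h2 (φ n) x)
      (fun x _ => hy₁ x) (Set.mem_univ t)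

end Compactness

/-! ### Passage to the limit in the minimality. -/

theorem TendstoLocallyUniformly.eventually_abs_le {F : ℕ → ℝ → ℝ} {f : ℝ → ℝ}
    (h : TendstoLocallyUniformly F f atTop) (hf : Continuous f) {T : Set ℝ} (hT : IsCompact T) :
    ∃ K : ℝ, ∀ᶠ n in atTop, ∀ s ∈ T, |F n s| ≤ K := by
  obtain ⟨K, hK⟩ := hT.exists_bound_of_continuousOn hf.continuousOn
  refine ⟨K + 1, ?_⟩
  have := Metric.tendstoUniformlyOn_iff.1
    (tendstoLocallyUniformly_iff_forall_isCompact.1 h T hT) 1 one_pos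
  filter_upwards [this] with n hn s hs
  have h1 := hn s hs
  have h2 := hK s hs
  rw [dist_comm, Real.dist_eq] at h1
  rw [Real.norm_eq_abs] at h2
  linarith [abs_sub_abs_le_abs_sub (F n s) (f s)]

theorem abs_painleve_variation_le {x x₁ p q φ φ₁ K : ℝ} (hx : |x| ≤ K) (hx₁ : |x₁| ≤ K)
    (hp : |p| ≤ K) (hq : |q| ≤ K) (hφ : |φ| ≤ K) (hφ₁ : |φ₁| ≤ K) :
    |x₁ * φ₁ + φ₁ ^ 2 / 2 + p / 2 * (2 * x * φ + φ ^ 2) + 1 / 2 * ((x + φ) ^ 4 - x ^ 4) + q * φ|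
      ≤ 3 * K ^ 2 + 2 * K ^ 3 + 8 * K ^ 4 := by
  have hK : 0 ≤ K := (abs_nonneg x).trans hx
  have mul : ∀ a b A B : ℝ, 0 ≤ A → |a| ≤ A → |b| ≤ B → |a * b| ≤ A * B := fun a b A B h0 ha hb => by
    rw [abs_mul]; gcongr
  have e : x₁ * φ₁ + φ₁ ^ 2 / 2 + p / 2 * (2 * x * φ + φ ^ 2) + 1 / 2 * ((x + φ) ^ 4 - x ^ 4) + q * φ
      = x₁ * φ₁ + φ₁ * φ₁ / 2 + p * (x * φ) + p * (φ * φ) / 2 + 2 * ((x * x) * (x * φ))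
        + 3 * ((x * x) * (φ * φ)) + 2 * ((x * φ) * (φ * φ)) + (φ * φ) * (φ * φ) / 2 + q * φ := by ring
  have hK2 : 0 ≤ K * K := by positivity
  have hK4 : 0 ≤ K ^ 4 := by positivity
  have hK3 : 0 ≤ K ^ 3 := by positivity
  have hxφ := mul x φ K K hK hx hφ
  have hxx := mul x x K K hK hx hx
  have hφφ := mul φ φ K K hK hφ hφ
  have b1 := abs_le.1 (mul x₁ φ₁ K K hK hx₁ hφ₁)
  have b2 := abs_le.1 (mul φ₁ φ₁ K K hK hφ₁ hφ₁)
  have b3 := abs_le.1 (mul p _ K _ hK hp hxφ)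
  have b4 := abs_le.1 (mul p _ K _ hK hp hφφ)
  have b5 := abs_le.1 (mul _ _ _ _ hK2 hxx hxφ)
  have b6 := abs_le.1 (mul _ _ _ _ hK2 hxx hφφ)
  have b7 := abs_le.1 (mul _ _ _ _ hK2 hxφ hφφ)
  have b8 := abs_le.1 (mul _ _ _ _ hK2 hφφ hφφ)
  have b9 := abs_le.1 (mul q φ K K hK hq hφ)
  have k3 : K * (K * K) = K ^ 3 := by ring
  have k4 : K * K * (K * K) = K ^ 4 := by ring
  have k2 : K * K = K ^ 2 := by ring
  rw [k3] at b3 b4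
  rw [k4] at b5 b6 b7 b8
  rw [k2] at b1 b2 b9 hK2
  rw [e, abs_le]
  constructor <;> linarith [b1.1, b1.2, b2.1, b2.2, b3.1, b3.2, b4.1, b4.2, b5.1, b5.2, b6.1, b6.2,
    b7.1, b7.2, b8.1, b8.2, b9.1, b9.2]

/-- Local minimality passes to the limit. -/
theorem painleve_variation_nonneg_of_tendsto {w w₁ p q : ℕ → ℝ → ℝ} {α : ℝ} {y y₁ φ : ℝ → ℝ}
    (hw : ∀ n, Continuous (w n)) (hw₁ : ∀ n, Continuous (w₁ n)) (hpc : ∀ n, Continuous (p n))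
    (hqc : ∀ n, Continuous (q n)) (hyc : Continuous y) (hy₁c : Continuous y₁)
    (hy : TendstoLocallyUniformly w y atTop) (hy₁ : TendstoLocallyUniformly w₁ y₁ atTop)
    (hp : TendstoLocallyUniformly p (fun s => s) atTop)
    (hq : TendstoLocallyUniformly q (fun _ => α) atTop)
    (hφ : ContDiff ℝ ∞ φ) (hc : HasCompactSupport φ)
    (hmin : ∀ n, 0 ≤ ∫ s, (w₁ n s * deriv φ s + deriv φ s ^ 2 / 2
      + p n s / 2 * (2 * w n s * φ s + φ s ^ 2)
      + 1 / 2 * ((w n s + φ s) ^ 4 - w n s ^ 4) + q n s * φ s)) :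
    0 ≤ ∫ s in tsupport φ, (y₁ s * deriv φ s + deriv φ s ^ 2 / 2
      + s / 2 * (2 * y s * φ s + φ s ^ 2) + 1 / 2 * ((y s + φ s) ^ 4 - y s ^ 4) + α * φ s) := by
  have hφ0 := hφ.continuous
  have hd : Continuous (deriv φ) := hφ.continuous_deriv (by simp)
  have hz : ∀ x, x ∉ tsupport φ → φ x = 0 ∧ deriv φ x = 0 := fun x hx =>
    ⟨image_eq_zero_of_notMem_tsupport hx,
      image_eq_zero_of_notMem_tsupport fun h => hx (tsupport_deriv_subset h)⟩
  have hT : IsCompact (tsupport φ) := hc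
  obtain ⟨K1, hK1⟩ := hy.eventually_abs_le hyc hT
  obtain ⟨K2, hK2⟩ := hy₁.eventually_abs_le hy₁c hT
  obtain ⟨K3, hK3⟩ := hp.eventually_abs_le continuous_id hT
  obtain ⟨K4, hK4⟩ := hq.eventually_abs_le continuous_const hT
  obtain ⟨K5, hK5⟩ := hT.exists_bound_of_continuousOn hφ0.continuousOn
  obtain ⟨K6, hK6⟩ := hT.exists_bound_of_continuousOn hd.continuousOn
  set K := |K1| + |K2| + |K3| + |K4| + |K5| + |K6| with hK
  have hKi : K1 ≤ K ∧ K2 ≤ K ∧ K3 ≤ K ∧ K4 ≤ K ∧ K5 ≤ K ∧ K6 ≤ K := by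
    have := abs_nonneg K1
    have := abs_nonneg K2
    have := abs_nonneg K3
    have := abs_nonneg K4
    have := abs_nonneg K5
    have := abs_nonneg K6
    refine ⟨?_, ?_, ?_, ?_, ?_, ?_⟩ <;>
      linarith [le_abs_self K1, le_abs_self K2, le_abs_self K3, le_abs_self K4, le_abs_self K5,
        le_abs_self K6]
  obtain ⟨k1, k2, k3, k4, k5, k6⟩ := hKi
  -- On the compact support all six quantities are eventually bounded by `K`, so a constant
  -- dominates.
  have lim := tendsto_integral_filter_of_dominated_convergence (μ := volume.restrict (tsupport φ))
    (l := atTop)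
    (F := fun n s => w₁ n s * deriv φ s + deriv φ s ^ 2 / 2
      + p n s / 2 * (2 * w n s * φ s + φ s ^ 2)
      + 1 / 2 * ((w n s + φ s) ^ 4 - w n s ^ 4) + q n s * φ s)
    (f := fun s => y₁ s * deriv φ s + deriv φ s ^ 2 / 2
      + s / 2 * (2 * y s * φ s + φ s ^ 2) + 1 / 2 * ((y s + φ s) ^ 4 - y s ^ 4) + α * φ s)
    (fun _ => 3 * K ^ 2 + 2 * K ^ 3 + 8 * K ^ 4)
    (Eventually.of_forall fun n => by
      have := hw n
      have := hw₁ n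
      have := hpc n
      have := hqc n
      exact Continuous.aestronglyMeasurable (by fun_prop))
    (by
      filter_upwards [hK1, hK2, hK3, hK4] with n h1 h2 h3 h4
      refine (ae_restrict_iff' hT.measurableSet).2 (Eventually.of_forall fun s hs => ?_)
      exact abs_painleve_variation_le ((h1 s hs).trans k1) ((h2 s hs).trans k2)
        ((h3 s hs).trans k3) ((h4 s hs).trans k4) ((hK5 s hs).trans k5) ((hK6 s hs).trans k6))
    (integrableOn_const hT.measure_lt_top.ne)
    (Eventually.of_forall fun s => by
      have a0 := hy.tendsto_apply s
      have a1 := hy₁.tendsto_apply s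
      have a2 := hp.tendsto_apply s
      have a3 := hq.tendsto_apply s
      exact ((((a1.mul_const _).add_const _).add ((a2.div_const 2).mul
        (((a0.const_mul 2).mul_const _).add_const _))).add
        ((((a0.add_const _).pow 4).sub (a0.pow 4)).const_mul _)).add (a3.mul_const _))
  refine ge_of_tendsto' lim fun n => ?_
  rw [setIntegral_eq_integral_of_forall_compl_eq_zero]
  · exact hmin n
  · intro s hs
    simp [hz s hs]

theorem isMinimalPainleveTwoSolution_of_variation_nonneg {α : ℝ} {y y₁ : ℝ → ℝ}
    (h1 : ∀ t, HasDerivAt y (y₁ t) t)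
    (h2 : ∀ t, HasDerivAt y₁ (2 * y t ^ 3 + t * y t + α) t)
    (hmin : ∀ φ : ℝ → ℝ, ContDiff ℝ ∞ φ → HasCompactSupport φ →
      0 ≤ ∫ s in tsupport φ, (y₁ s * deriv φ s + deriv φ s ^ 2 / 2
        + s / 2 * (2 * y s * φ s + φ s ^ 2) + 1 / 2 * ((y s + φ s) ^ 4 - y s ^ 4) + α * φ s)) :
    IsMinimalPainleveTwoSolution α y := by
  have hyc : Continuous y := continuous_iff_continuousAt.2 fun t => (h1 t).continuousAt
  have hy₁c : Continuous y₁ := continuous_iff_continuousAt.2 fun t => (h2 t).continuousAt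
  have d1 : deriv y = y₁ := funext fun t => (h1 t).deriv
  have d2 : deriv y₁ = fun t => 2 * y t ^ 3 + t * y t + α := funext fun t => (h2 t).deriv
  refine ⟨⟨?_, fun s => ?_⟩, fun φ hφ hc => ?_⟩
  · have hC1 : ContDiff ℝ 1 y₁ := by
      rw [contDiff_one_iff_deriv, d2]
      exact ⟨fun t => (h2 t).differentiableAt, by fun_prop⟩
    rw [show (2 : WithTop ℕ∞) = 1 + 1 by norm_num, contDiff_succ_iff_deriv, d1]
    exact ⟨fun t => (h1 t).differentiableAt, by simp, hC1⟩
  · rw [d1, d2]; ring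
  · have hφ0 := hφ.continuous
    have hd : Continuous (deriv φ) := hφ.continuous_deriv (by simp)
    have hT : IsCompact (tsupport φ) := hc
    have d3 : deriv (fun s => y s + φ s) = fun s => y₁ s + deriv φ s := funext fun s =>
      ((h1 s).add (hφ.differentiable (by simp) s).hasDerivAt).deriv
    rw [painleveTwoEnergy, painleveTwoEnergy, d1, d3, ← sub_nonneg, ← integral_sub]
    · refine (hmin φ hφ hc).trans_eq (integral_congr_ae (Eventually.of_forall fun s => ?_))
      simp only [sq_abs]
      ring
    · exact Continuous.continuousOn (by fun_prop) |>.integrableOn_compact hT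
    · exact Continuous.continuousOn (by fun_prop) |>.integrableOn_compact hT

/-! ### Reflection symmetry. -/

theorem IsH1With.neg_comp_neg {u g : ℝ → ℝ} (h : IsH1With u g) :
    IsH1With (fun x => -u (-x)) (fun x => g (-x)) := by
  have hn := Measure.measurePreserving_neg (volume : Measure ℝ)
  refine ⟨(h.memLp.comp_measurePreserving hn).neg, h.memLp_weakDeriv.comp_measurePreserving hn,
    fun φ hφ hc => ?_⟩
  have hd : ∀ x, deriv (fun x => φ (-x)) x = -deriv φ (-x) := fun x => deriv_comp_neg φ x
  have h1 := h.integral_mul_deriv (fun x => φ (-x)) (hφ.comp contDiff_neg)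
    (hc.comp_homeomorph (Homeomorph.neg ℝ))
  rw [← integral_neg_eq_self (fun x => -u (-x) * deriv φ x),
    ← integral_neg_eq_self (fun x => g (-x) * φ x)]
  simp only [neg_neg]
  rw [← h1]
  refine integral_congr_ae (Eventually.of_forall fun x => ?_)
  simp only [hd]
  ring

theorem lightEnergy_neg_comp_neg {μ f : ℝ → ℝ} (hμ : Function.Even μ) (hf : Function.Odd f)
    (a ε : ℝ) (u g : ℝ → ℝ) :
    lightEnergy μ f a ε (fun x => -u (-x)) (fun x => g (-x)) = lightEnergy μ f a ε u g := by
  rw [lightEnergy, lightEnergy, ← integral_neg_eq_self]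
  refine integral_congr_ae (Eventually.of_forall fun x => ?_)
  simp only [neg_neg, hμ x, hf x, abs_neg]
  ring

theorem IsGlobalMinimizer.neg_comp_neg {μ f v : ℝ → ℝ} {a ε : ℝ} (hμ : Function.Even μ)
    (hf : Function.Odd f) (h : IsGlobalMinimizer μ f a ε v) :
    IsGlobalMinimizer μ f a ε fun x => -v (-x) := by
  obtain ⟨hv, g, hg, hmin⟩ := h
  refine ⟨(hv.comp continuous_neg).neg, _, hg.neg_comp_neg, fun u u' hu => ?_⟩
  -- The reflection is an involution, so a competitor `u` is tested through its own reflection.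
  rw [lightEnergy_neg_comp_neg hμ hf, ← lightEnergy_neg_comp_neg hμ hf a ε u]
  exact hmin _ _ hu.neg_comp_neg

theorem rescaledProfile_neg_one (μ₁ ξ ε : ℝ) (v : ℝ → ℝ) :
    rescaledProfile (-1) μ₁ ξ ε v = rescaledProfile 1 μ₁ ξ ε fun x => -v (-x) := by
  funext s
  simp only [rescaledProfile]
  rw [show -1 * ξ + -1 * (ε ^ (2 / 3 : ℝ) * (s / (-μ₁) ^ (1 / 3 : ℝ)))
    = -(1 * ξ + 1 * (ε ^ (2 / 3 : ℝ) * (s / (-μ₁) ^ (1 / 3 : ℝ)))) by ring]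
  ring

/-! ### Limits of the coefficients and conclusion. -/

/-- Differentiability at `ξ` alone suffices: `-μ(ξ + l s) = m l s + o(l)` uniformly for bounded `s`.
-/
theorem tendstoLocallyUniformly_difference_quotient {μ : ℝ → ℝ} {ξ m : ℝ} (hm : 0 < m)
    (hμ : HasDerivAt μ (-m) ξ) (hμξ : μ ξ = 0) {l : ℕ → ℝ} (hl : ∀ n, 0 < l n)
    (hl0 : Tendsto l atTop (𝓝 0)) :
    TendstoLocallyUniformly (fun n s => -μ (ξ + l n * s) / (m * l n)) (fun s => s) atTop := by
  rw [tendstoLocallyUniformly_iff_abs_le]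
  intro R η hη
  have hR : 0 < |R| + 1 := by positivity
  set κ := η * m / (|R| + 1) with hκ
  have hκ0 : 0 < κ := by positivity
  have h1 := (hasDerivAt_iff_isLittleO_nhds_zero.1 hμ).def hκ0
  obtain ⟨δ, hδ, hball⟩ := Metric.eventually_nhds_iff.1 h1
  filter_upwards [Metric.tendsto_nhds.1 hl0 (δ / (|R| + 1)) (by positivity)] with n hn s hs
  rw [Real.dist_eq, sub_zero, abs_of_pos (hl n), lt_div_iff₀ hR] at hn
  have hs' : |s| < |R| + 1 := by linarith [le_abs_self R]
  have h2 := hball (y := l n * s) (by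
    rw [Real.dist_eq, sub_zero, abs_mul, abs_of_pos (hl n)]
    exact (mul_le_mul_of_nonneg_left hs'.le (hl n).le).trans_lt hn)
  rw [hμξ, Real.norm_eq_abs, Real.norm_eq_abs, abs_mul, abs_of_pos (hl n), smul_eq_mul] at h2
  have hml : 0 < m * l n := mul_pos hm (hl n)
  have e : -μ (ξ + l n * s) / (m * l n) - s
      = -(μ (ξ + l n * s) - 0 - l n * s * -m) / (m * l n) := by
    field_simp [hm.ne', (hl n).ne']; ring
  rw [e, abs_div, abs_neg, abs_of_pos hml, div_le_iff₀ hml]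
  refine h2.trans ?_
  calc κ * (l n * |s|) ≤ κ * (l n * (|R| + 1)) := by
        have := hl n
        gcongr
    _ = η * (m * l n) := by rw [hκ]; field_simp

theorem tendstoLocallyUniformly_comp_add_mul {F : ℝ → ℝ} (hF : Continuous F) (ξ : ℝ) {l : ℕ → ℝ}
    (hl0 : Tendsto l atTop (𝓝 0)) :
    TendstoLocallyUniformly (fun n s => F (ξ + l n * s)) (fun _ => F ξ) atTop := by
  rw [tendstoLocallyUniformly_iff_abs_le]
  intro R η hη
  have hR : 0 < |R| + 1 := by positivity
  obtain ⟨δ, hδ, hball⟩ := Metric.continuousAt_iff.1 (hF.continuousAt (x := ξ)) η hη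
  filter_upwards [Metric.tendsto_nhds.1 hl0 (δ / (|R| + 1)) (by positivity)] with n hn s hs
  rw [Real.dist_eq, sub_zero, lt_div_iff₀ hR] at hn
  have hs' : |s| ≤ |R| + 1 := by linarith [le_abs_self R]
  have := hball (x := ξ + l n * s) (by
    rw [Real.dist_eq, add_sub_cancel_left, abs_mul]
    exact (mul_le_mul_of_nonneg_left hs' (abs_nonneg _)).trans_lt hn)
  rw [Real.dist_eq] at this
  exact this.le

/-- The profile near `ξ`. -/
theorem exists_subseq_tendstoC1Loc_rescaledProfile
    {μ f : ℝ → ℝ} {ξ a : ℝ}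
    (hμ_C1 : ContDiff ℝ 1 μ) (hμ_bdd : ∃ M : ℝ, ∀ x, |μ x| ≤ M)
    (hμ_deriv : deriv μ ξ < 0) (hμξ : μ ξ = 0)
    (hf_cont : Continuous f) (hf_int : Integrable f)
    {ε : ℕ → ℝ} (hε_pos : ∀ n, 0 < ε n) (hε : Tendsto ε atTop (𝓝 0))
    {v : ℕ → ℝ → ℝ} (hv : ∀ n, IsGlobalMinimizer μ f a (ε n) (v n)) :
    ∃ φ : ℕ → ℕ, StrictMono φ ∧ ∃ y : ℝ → ℝ,
      TendstoC1Loc (fun n => rescaledProfile 1 (deriv μ ξ) ξ (ε (φ n)) (v (φ n))) y ∧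
        IsMinimalPainleveTwoSolution (a * f ξ / (√2 * deriv μ ξ)) y ∧ BoundedAtTop y := by
  set m := -deriv μ ξ with hm_def
  have hm : 0 < m := neg_pos.2 hμ_deriv
  have hdμ : HasDerivAt μ (-m) ξ := by
    rw [hm_def, neg_neg]
    exact (hμ_C1.differentiable (by simp) ξ).hasDerivAt
  have hα : a * f ξ / (√2 * deriv μ ξ) = -(a * f ξ) / (√2 * m) := by
    rw [hm_def, mul_neg, neg_div_neg_eq]
  rw [hα]
  set l : ℕ → ℝ := fun n => ε n ^ (2 / 3 : ℝ) / m ^ (1 / 3 : ℝ) with hl_def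
  set c : ℕ → ℝ := fun n => (2 : ℝ) ^ (1 / 2 : ℝ) * (m * ε n) ^ (1 / 3 : ℝ) with hc_def
  have hl : ∀ n, 0 < l n := fun n =>
    div_pos (Real.rpow_pos_of_pos (hε_pos n) _) (Real.rpow_pos_of_pos hm _)
  have hc : ∀ n, 0 < c n := fun n => mul_pos (Real.rpow_pos_of_pos two_pos _)
    (Real.rpow_pos_of_pos (mul_pos hm (hε_pos n)) _)
  have hl0 : Tendsto l atTop (𝓝 0) := by
    have := (hε.rpow_const (p := (2 / 3 : ℝ)) (Or.inr (by norm_num))).div_const (m ^ (1 / 3 : ℝ))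
    rwa [Real.zero_rpow (by norm_num), zero_div] at this
  have hcl : ∀ n, c n * l n = √2 * ε n := fun n => by
    have h1 : ε n ^ (1 / 3 : ℝ) * ε n ^ (2 / 3 : ℝ) = ε n := by
      rw [← Real.rpow_add (hε_pos n)]; norm_num
    have h2 : m ^ (1 / 3 : ℝ) ≠ 0 := (Real.rpow_pos_of_pos hm _).ne'
    simp only [hc_def, hl_def]
    rw [Real.mul_rpow hm.le (hε_pos n).le, Real.sqrt_eq_rpow]
    field_simp
    linear_combination h1
  have hlm : ∀ n, l n ^ 3 * m = ε n ^ 2 := fun n => by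
    have h1 : (ε n ^ (2 / 3 : ℝ)) ^ 3 = ε n ^ 2 := by
      rw [← Real.rpow_natCast, ← Real.rpow_mul (hε_pos n).le, ← Real.rpow_natCast]; norm_num
    have h2 : (m ^ (1 / 3 : ℝ)) ^ 3 = m := by
      rw [← Real.rpow_natCast, ← Real.rpow_mul hm.le]; norm_num
    simp only [hl_def]
    rw [div_pow, h1, h2]
    field_simp
  set w : ℕ → ℝ → ℝ := fun n => rescaledProfile 1 (deriv μ ξ) ξ (ε n) (v n) with hw_def
  set p : ℕ → ℝ → ℝ := fun n s => -μ (ξ + l n * s) / (m * l n) with hp_def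
  set q : ℕ → ℝ → ℝ := fun n s => -(a * f (ξ + l n * s)) / (√2 * m) with hq_def
  have hw : ∀ n s, w n s = (c n)⁻¹ * v n (ξ + l n * s) := fun n s => by
    have e : 1 * ξ + 1 * (ε n ^ (2 / 3 : ℝ) * (s / m ^ (1 / 3 : ℝ))) = ξ + l n * s := by
      simp only [hl_def]; ring
    simp only [hw_def, rescaledProfile]
    rw [← hm_def, e, Real.rpow_neg two_pos.le, Real.rpow_neg (mul_pos hm (hε_pos n)).le]
    simp only [hc_def, mul_inv]
    ring
  have hre := fun n => (hv n).rescale hμ_C1.continuous hμ_bdd hf_int hf_cont (hε_pos n) ξ hm (hl n)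
    (hc n) (hcl n) (hlm n) (p := p n) (q := q n) (hw n) (fun _ => rfl) fun _ => rfl
  choose w₁ h1 h2 hmin using hre
  have hp : TendstoLocallyUniformly p (fun s => s) atTop :=
    tendstoLocallyUniformly_difference_quotient hm hdμ hμξ hl hl0
  have hq : TendstoLocallyUniformly q (fun _ => -(a * f ξ) / (√2 * m)) atTop :=
    tendstoLocallyUniformly_comp_add_mul (F := fun x => -(a * f x) / (√2 * m)) (by fun_prop) ξ hl0
  obtain ⟨φ, hφ, y, y₁, hy, hy₁, d1, d2⟩ := exists_subseq_tendsto_of_perturbed_painleve h1 h2 hp hq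
  have hwc : ∀ n, Continuous (w n) := fun n =>
    continuous_iff_continuousAt.2 fun t => (h1 n t).continuousAt
  have hw₁c : ∀ n, Continuous (w₁ n) := fun n =>
    continuous_iff_continuousAt.2 fun t => (h2 n t).continuousAt
  have hμc := hμ_C1.continuous
  have hyc : Continuous y := continuous_iff_continuousAt.2 fun t => (d1 t).continuousAt
  have hy₁c : Continuous y₁ := continuous_iff_continuousAt.2 fun t => (d2 t).continuousAt
  have dw : ∀ n, deriv (w n) = w₁ n := fun n => funext fun t => (h1 n t).deriv
  have dy : deriv y = y₁ := funext fun t => (d1 t).deriv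
  refine ⟨φ, hφ, y, ⟨fun n => ?_, ?_, hy, ?_⟩, ?_, boundedAtTop_of_painleve d1 d2⟩
  · exact contDiff_one_iff_deriv.2
      ⟨fun t => (h1 (φ n) t).differentiableAt, by rw [dw]; exact hw₁c _⟩
  · exact contDiff_one_iff_deriv.2 ⟨fun t => (d1 t).differentiableAt, by rw [dy]; exact hy₁c⟩
  · have : (fun n => deriv (w (φ n))) = fun n => w₁ (φ n) := funext fun n => dw (φ n)
    rw [dy]
    exact this ▸ hy₁
  · refine isMinimalPainleveTwoSolution_of_variation_nonneg d1 d2 fun ψ hψ hψc => ?_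
    exact painleve_variation_nonneg_of_tendsto (w := fun n => w (φ n)) (w₁ := fun n => w₁ (φ n))
      (fun n => hwc _) (fun n => hw₁c _) (p := fun n => p (φ n)) (q := fun n => q (φ n))
      (fun n => by simp only [hp_def]; fun_prop)
      (fun n => by simp only [hq_def]; fun_prop) hyc hy₁c hy hy₁
      (hp.comp_strictMono hφ) (hq.comp_strictMono hφ) hψ hψc fun n => hmin (φ n) ψ hψ hψc

theorem TendstoC1Loc.comp_strictMono {w : ℕ → ℝ → ℝ} {y : ℝ → ℝ} (h : TendstoC1Loc w y)
    {φ : ℕ → ℕ} (hφ : StrictMono φ) : TendstoC1Loc (fun n => w (φ n)) y :=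
  ⟨fun n => h.1 (φ n), h.2.1, h.2.2.1.comp_strictMono hφ, h.2.2.2.comp_strictMono hφ⟩

theorem theorem2
    (μ f : ℝ → ℝ) (ξ a : ℝ)
    (hμ_C1 : ContDiff ℝ 1 μ) (hμ_bdd : ∃ M : ℝ, ∀ x, |μ x| ≤ M) (hμ_even : Function.Even μ)
    (hμ_deriv : ∀ x, 0 < x → deriv μ x < 0) (hξ : 0 < ξ) (hμξ : μ ξ = 0)
    (hf_cont : Continuous f) (hf_int : Integrable f) (hf_bdd : ∃ M : ℝ, ∀ x, |f x| ≤ M)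
    (hf_odd : Function.Odd f) (hf_pos : ∀ x, 0 < x → 0 < f x)
    (ha : 0 ≤ a)
    (α : ℝ) (hα : α = a * f ξ / (√2 * deriv μ ξ))
    (ε : ℕ → ℝ) (hε_pos : ∀ n, 0 < ε n) (hε : Tendsto ε atTop (𝓝 0))
    (v : ℕ → ℝ → ℝ) (hv : ∀ n, IsGlobalMinimizer μ f a (ε n) (v n)) :
    α ≤ 0 ∧ (0 < a → α < 0) ∧
    ∃ φ : ℕ → ℕ, StrictMono φ ∧ ∃ yp ym : ℝ → ℝ,
      (TendstoC1Loc (fun n => rescaledProfile 1 (deriv μ ξ) ξ (ε (φ n)) (v (φ n))) yp ∧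
        IsMinimalPainleveTwoSolution α yp ∧ BoundedAtTop yp) ∧
      (TendstoC1Loc (fun n => rescaledProfile (-1) (deriv μ ξ) ξ (ε (φ n)) (v (φ n))) ym ∧
        IsMinimalPainleveTwoSolution α ym ∧ BoundedAtTop ym) := by
  have hd : deriv μ ξ < 0 := hμ_deriv ξ hξ
  have hs : √2 * deriv μ ξ < 0 := mul_neg_of_pos_of_neg (by positivity) hd
  have hfξ := hf_pos ξ hξ
  subst hα
  refine ⟨div_nonpos_of_nonneg_of_nonpos (mul_nonneg ha hfξ.le) hs.le,
    fun ha' => div_neg_of_pos_of_neg (mul_pos ha' hfξ) hs, ?_⟩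
  obtain ⟨φ, hφ, yp, hyp, hyp'⟩ := exists_subseq_tendstoC1Loc_rescaledProfile hμ_C1 hμ_bdd hd hμξ
    hf_cont hf_int hε_pos hε hv
  -- The second extraction starts from the first subsequence, so that one subsequence serves both
  -- profiles.
  obtain ⟨ψ, hψ, ym, hym, hym'⟩ := exists_subseq_tendstoC1Loc_rescaledProfile hμ_C1 hμ_bdd hd hμξ
    hf_cont hf_int (fun n => hε_pos (φ n)) (hε.comp hφ.tendsto_atTop)
    fun n => (hv (φ n)).neg_comp_neg hμ_even hf_odd
  refine ⟨fun n => φ (ψ n), hφ.comp hψ, yp, ym, ⟨hyp.comp_strictMono hψ, hyp'⟩, ?_, hym'⟩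
  simp only [rescaledProfile_neg_one]
  exact hym
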